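/- Let $d \ge 2$ and $n \ge 2$ be integers and let $p \ge 2$ be real. Let $\xi_1, \dots, \xi_n$ be independent random vectors, each uniformly distributed on the unit Euclidean sphere $S^{d-1}$ in $\mathbb{R}^d$, and let $|\cdot|$ denote the Euclidean norm on $\mathbb{R}^d$. Then for all real numbers $a_1, \dots, a_n$ with $\sum_{j=1}^n a_j^2 = 1$, \[ \mathbb{E}\left|\sum_{j=1}^n a_j\xi_j\right|^p \leq \mathbb{E}\left|\sum_{j=1}^n \frac{1}{\sqrt{n}}\,\xi_j\right|^p - \tilde{c}_{p,d}\sum_{j=1}^n \left(\frac{1}{n}-a_j^2\right)^2, \] where \[ \tilde{c}_{p,d} = \frac{p(p-2)}{4d}\cdot\begin{cases} \dfrac{(p+d-2)(p+d-4)}{d(d+2)}, & 2 \leq p \leq 4, \\[2mm] 0.385, & p > 4. \end{cases} \] -/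

import Mathlib

open MeasureTheory ProbabilityTheory

/-- The uniform distribution on the unit Euclidean sphere `S^{d-1}`, viewed as a measure on
`ℝ^d`: the normalised surface measure of the sphere, pushed forward along the inclusion. -/
noncomputable def sphereUniform (d : ℕ) : Measure (EuclideanSpace ℝ (Fin d)) :=
  (((volume : Measure (EuclideanSpace ℝ (Fin d))).toSphere Set.univ)⁻¹ •
    (volume : Measure (EuclideanSpace ℝ (Fin d))).toSphere).map Subtype.val

/-- The constant in front of the deficit term. -/
noncomputable def deficitConst (p : ℝ) (d : ℕ) : ℝ :=
  p * (p - 2) / (4 * (d : ℝ)) *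
    (if p ≤ 4 then (p + d - 2) * (p + d - 4) / ((d : ℝ) * ((d : ℝ) + 2)) else 0.385)

open scoped Pointwise in
theorem sphereUniform_map_linearIsometryEquiv (d : ℕ)
    (L : EuclideanSpace ℝ (Fin d) ≃ₗᵢ[ℝ] EuclideanSpace ℝ (Fin d)) :
    (sphereUniform d).map L = sphereUniform d := by
  have key : ∀ s : Set (EuclideanSpace ℝ (Fin d)), MeasurableSet s →
      sphereUniform d s = ((volume : Measure (EuclideanSpace ℝ (Fin d))).toSphere Set.univ)⁻¹ *
        (Module.finrank ℝ (EuclideanSpace ℝ (Fin d)) *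
          volume (Set.Ioo (0 : ℝ) 1 • (Metric.sphere 0 1 ∩ s))) := by
    intro s hs
    rw [sphereUniform, Measure.map_apply measurable_subtype_coe hs, Measure.smul_apply,
      Measure.toSphere_apply' _ (measurable_subtype_coe hs), Subtype.image_preimage_coe,
      smul_eq_mul]
  ext s hs
  rw [Measure.map_apply L.continuous.measurable hs, key _ (L.continuous.measurable hs), key _ hs]
  congr 2
  have : Set.Ioo (0 : ℝ) 1 • (Metric.sphere 0 1 ∩ L ⁻¹' s) =
      L ⁻¹' (Set.Ioo (0 : ℝ) 1 • (Metric.sphere 0 1 ∩ s)) := by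
    ext x
    simp only [Set.mem_smul, Set.mem_inter_iff, Set.mem_preimage, mem_sphere_zero_iff_norm]
    constructor
    · rintro ⟨r, hr, y, ⟨hy, hys⟩, rfl⟩
      exact ⟨r, hr, L y, ⟨by simpa using hy, hys⟩, by simp⟩
    · rintro ⟨r, hr, y, ⟨hy, hys⟩, h⟩
      refine ⟨r, hr, L.symm y, ⟨by simpa using hy, by simpa using hys⟩, ?_⟩
      apply L.injective
      simpa using h
  rw [this]
  exact L.measurePreserving.measure_preimage_equiv (f := L.toMeasurableEquiv) _

theorem isProbabilityMeasure_sphereUniform {d : ℕ} (hd : 0 < d) :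
    IsProbabilityMeasure (sphereUniform d) := by
  have : Nontrivial (EuclideanSpace ℝ (Fin d)) := by
    have : Nonempty (Fin d) := ⟨⟨0, hd⟩⟩
    infer_instance
  constructor
  rw [sphereUniform, Measure.map_apply measurable_subtype_coe MeasurableSet.univ, Set.preimage_univ,
    Measure.smul_apply, smul_eq_mul]
  refine ENNReal.inv_mul_cancel ?_ (measure_ne_top _ _)
  rw [Ne, Measure.measure_univ_eq_zero]
  exact Measure.toSphere_ne_zero _

theorem norm_eq_one_ae_sphereUniform (d : ℕ) : ∀ᵐ x ∂(sphereUniform d), ‖x‖ = 1 := by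
  rw [sphereUniform, ae_map_iff measurable_subtype_coe.aemeasurable
    (measurableSet_eq_fun measurable_norm measurable_const)]
  exact Filter.Eventually.of_forall fun x => by simp

theorem ContinuousOn.integrable_of_ae_mem_compact {X : Type*} [MetricSpace X] [MeasurableSpace X]
    [BorelSpace X] {μ : Measure X} [IsFiniteMeasure μ] {K : Set X}
    (hK : IsCompact K) (hμ : ∀ᵐ x ∂μ, x ∈ K) {F : X → ℝ} (hF : ContinuousOn F K) :
    Integrable F μ := by
  have h := hF.integrableOn_compact (μ := μ) hK
  rwa [IntegrableOn, Measure.restrict_eq_self_of_ae_mem hμ] at h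

theorem hasDerivAt_integral_of_ae_mem_compact {X : Type*} [MetricSpace X] [MeasurableSpace X]
    [BorelSpace X] {μ : Measure X} [IsFiniteMeasure μ] {K : Set X}
    (hK : IsCompact K) (hμ : ∀ᵐ x ∂μ, x ∈ K) {F F' : ℝ → X → ℝ}
    (hF : ∀ r, ∀ x ∈ K, HasDerivAt (fun r => F r x) (F' r x) r)
    (hFc : ∀ r, ContinuousOn (F r) K)
    (hF' : ContinuousOn (Function.uncurry F') (Set.univ ×ˢ K)) (r₀ : ℝ) :
    HasDerivAt (fun r => ∫ x, F r x ∂μ) (∫ x, F' r₀ x ∂μ) r₀ := by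
  have hc : IsCompact (Set.Icc (r₀ - 1) (r₀ + 1) ×ˢ K) := isCompact_Icc.prod hK
  obtain ⟨C, hC⟩ := hc.exists_bound_of_continuousOn
    (hF'.mono (Set.prod_mono (Set.subset_univ _) subset_rfl))
  have hF'r : ∀ r, ContinuousOn (F' r) K := fun r =>
    hF'.comp (f := fun x => (r, x)) (by fun_prop) fun x hx => ⟨trivial, hx⟩
  refine (hasDerivAt_integral_of_dominated_loc_of_deriv_le (bound := fun _ => C)
    (s := Set.Icc (r₀ - 1) (r₀ + 1)) (Icc_mem_nhds (by linarith) (by linarith))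
    (Filter.Eventually.of_forall fun r => ?_) ?_ ?_ ?_ (integrable_const C) ?_).2
  · exact ((hFc r).integrable_of_ae_mem_compact hK hμ).aestronglyMeasurable
  · exact (hFc r₀).integrable_of_ae_mem_compact hK hμ
  · exact ((hF'r r₀).integrable_of_ae_mem_compact hK hμ).aestronglyMeasurable
  · filter_upwards [hμ] with x hx r hr using hC (r, x) ⟨hr, hx⟩
  · filter_upwards [hμ] with x hx r _ using hF r x hx

/-- The properties of the law of a coordinate of a uniform point of the unit sphere of `ℝ^d` on
which the analysis rests; the last one is the Stein identity. -/
structure IsSphereMarginal (d : ℕ) (ν : Measure ℝ) : Prop where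
  prob : IsProbabilityMeasure ν
  mem_Icc : ∀ᵐ c ∂ν, c ∈ Set.Icc (-1 : ℝ) 1
  map_neg : ν.map (fun c => -c) = ν
  stein : ∀ φ φ' : ℝ → ℝ, (∀ w ∈ Set.Icc (-1 : ℝ) 1, HasDerivAt φ (φ' w) w) →
    ContinuousOn φ' (Set.Icc (-1) 1) → ∫ c, (1 - c ^ 2) * φ' c ∂ν = (d - 1) * ∫ c, c * φ c ∂ν

theorem stein_coordinate_sphereUniform {d : ℕ} {i j : Fin d} (hij : i ≠ j) {φ φ' : ℝ → ℝ}
    (hφ : ∀ w ∈ Set.Icc (-1 : ℝ) 1, HasDerivAt φ (φ' w) w)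
    (hφ' : ContinuousOn φ' (Set.Icc (-1) 1)) :
    ∫ x, x j ^ 2 * φ' (x i) ∂(sphereUniform d) = ∫ x, x i * φ (x i) ∂(sphereUniform d) := by
  have : IsProbabilityMeasure (sphereUniform d) := isProbabilityMeasure_sphereUniform i.pos
  have hφc : ContinuousOn φ (Set.Icc (-1) 1) := fun w hw => (hφ w hw).continuousAt.continuousWithinAt
  set K : Set (EuclideanSpace ℝ (Fin d)) := Metric.sphere 0 1 with hKdef
  have hK : IsCompact K := isCompact_sphere 0 1
  have hμ : ∀ᵐ x ∂(sphereUniform d), x ∈ K := by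
    filter_upwards [norm_eq_one_ae_sphereUniform d] with x hx
    simpa [hKdef] using hx
  have hsq : ∀ x ∈ K, x i ^ 2 + x j ^ 2 ≤ 1 := by
    intro x hx
    have h1 : ‖x‖ ^ 2 = 1 := by rw [mem_sphere_zero_iff_norm.1 hx]; norm_num
    rw [EuclideanSpace.norm_sq_eq] at h1
    rw [← h1, ← Finset.sum_pair (f := fun k => x k ^ 2) hij]
    simp only [Real.norm_eq_abs, sq_abs]
    exact Finset.sum_le_sum_of_subset_of_nonneg (Finset.subset_univ _) fun _ _ _ => sq_nonneg _
  have hmem : ∀ θ : ℝ, ∀ x ∈ K, Real.cos θ * x i + Real.sin θ * x j ∈ Set.Icc (-1 : ℝ) 1 := by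
    intro θ x hx
    rw [Set.mem_Icc, ← abs_le, ← sq_le_one_iff_abs_le_one]
    nlinarith [hsq x hx, sq_nonneg (Real.sin θ * x i - Real.cos θ * x j), Real.sin_sq_add_cos_sq θ]
  set F : ℝ → EuclideanSpace ℝ (Fin d) → ℝ := fun θ x =>
    φ (Real.cos θ * x i + Real.sin θ * x j) * (Real.sin θ * x i - Real.cos θ * x j) with hFdef
  set F' : ℝ → EuclideanSpace ℝ (Fin d) → ℝ := fun θ x =>
    φ' (Real.cos θ * x i + Real.sin θ * x j) * (-Real.sin θ * x i + Real.cos θ * x j) *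
      (Real.sin θ * x i - Real.cos θ * x j) +
    φ (Real.cos θ * x i + Real.sin θ * x j) * (Real.cos θ * x i + Real.sin θ * x j) with hF'def
  have hder := hasDerivAt_integral_of_ae_mem_compact (F := F) (F' := F') hK hμ (by
      intro θ x hx
      have h1 : HasDerivAt (fun θ => Real.cos θ * x i + Real.sin θ * x j)
          (-Real.sin θ * x i + Real.cos θ * x j) θ :=
        ((Real.hasDerivAt_cos θ).mul_const _).add ((Real.hasDerivAt_sin θ).mul_const _)
      have h2 : HasDerivAt (fun θ => Real.sin θ * x i - Real.cos θ * x j)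
          (Real.cos θ * x i + Real.sin θ * x j) θ := by
        exact (((Real.hasDerivAt_sin θ).mul_const (x i)).sub
          ((Real.hasDerivAt_cos θ).mul_const (x j))).congr_deriv (by ring)
      exact ((hφ _ (hmem θ x hx)).comp θ h1).mul h2) (by
      intro θ
      refine ContinuousOn.mul (hφc.comp (by fun_prop) (hmem θ)) (by fun_prop)) (by
      have hm : Set.MapsTo (fun q : ℝ × EuclideanSpace ℝ (Fin d) =>
          Real.cos q.1 * q.2 i + Real.sin q.1 * q.2 j) (Set.univ ×ˢ K) (Set.Icc (-1) 1) :=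
        fun q hq => hmem q.1 q.2 hq.2
      have hcont : ContinuousOn (fun q : ℝ × EuclideanSpace ℝ (Fin d) =>
          Real.cos q.1 * q.2 i + Real.sin q.1 * q.2 j) (Set.univ ×ˢ K) := by fun_prop
      exact (((hφ'.comp hcont hm).mul (by fun_prop)).mul (by fun_prop)).add
        ((hφc.comp hcont hm).mul (by fun_prop))) 0
  have hconst : ∀ θ, ∫ x, F θ x ∂(sphereUniform d) = ∫ x, φ (x i) * x j ∂(sphereUniform d) := by
    intro θ
    set n : EuclideanSpace ℝ (Fin d) := Real.sin (θ / 2) • EuclideanSpace.single i 1 -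
      Real.cos (θ / 2) • EuclideanSpace.single j 1 with hn
    have hni : n i = Real.sin (θ / 2) := by simp [hn, hij]
    have hnj : n j = -Real.cos (θ / 2) := by simp [hn, hij.symm]
    have hin : ∀ x, inner ℝ n x = Real.sin (θ / 2) * x i - Real.cos (θ / 2) * x j := by
      intro x
      simp [hn, inner_sub_left, inner_smul_left, EuclideanSpace.inner_single_left]
    have hnn : ‖n‖ ^ 2 = 1 := by
      rw [← real_inner_self_eq_norm_sq, hin, hni, hnj]
      linarith [Real.sin_sq_add_cos_sq (θ / 2)]
    set L := (Submodule.span ℝ {n})ᗮ.reflection with hL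
    have hLx : ∀ x, L x = x - (2 * inner ℝ n x) • n := by
      intro x
      rw [hL, Submodule.reflection_orthogonal_apply, Submodule.reflection_singleton_apply,
        RCLike.ofReal_real_eq_id, id, hnn, div_one, neg_sub, two_smul, two_mul, add_smul]
    have hs : Real.sin θ = 2 * Real.sin (θ / 2) * Real.cos (θ / 2) := by
      rw [← Real.sin_two_mul]; congr 1; ring
    have hc : Real.cos θ = 2 * Real.cos (θ / 2) ^ 2 - 1 := by
      rw [← Real.cos_two_mul]; congr 1; ring
    have hLi : ∀ x, L x i = Real.cos θ * x i + Real.sin θ * x j := by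
      intro x
      rw [hLx, PiLp.sub_apply, PiLp.smul_apply, hin, hni, smul_eq_mul, hs, hc]
      linear_combination (-2) * x i * Real.sin_sq_add_cos_sq (θ / 2)
    have hLj : ∀ x, L x j = Real.sin θ * x i - Real.cos θ * x j := by
      intro x
      rw [hLx, PiLp.sub_apply, PiLp.smul_apply, hin, hnj, smul_eq_mul, hs, hc]
      ring
    have hmp : MeasurePreserving L (sphereUniform d) (sphereUniform d) :=
      ⟨L.continuous.measurable, sphereUniform_map_linearIsometryEquiv d L⟩
    have := hmp.integral_comp (f := L) L.toHomeomorph.measurableEmbedding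
      (fun x => φ (x i) * x j)
    rw [← this]
    simp only [hLi, hLj, hFdef]
  have h0 : HasDerivAt (fun θ => ∫ x, F θ x ∂(sphereUniform d)) 0 0 := by
    simp only [hconst]
    exact hasDerivAt_const _ _
  have heq := hder.unique h0
  have hint1 : Integrable (fun x : EuclideanSpace ℝ (Fin d) => x j ^ 2 * φ' (x i))
      (sphereUniform d) := by
    refine ContinuousOn.integrable_of_ae_mem_compact hK hμ (ContinuousOn.mul (by fun_prop)
      (hφ'.comp (by fun_prop) fun x hx => ?_))
    simpa using hmem 0 x hx
  have hint2 : Integrable (fun x : EuclideanSpace ℝ (Fin d) => x i * φ (x i))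
      (sphereUniform d) := by
    refine ContinuousOn.integrable_of_ae_mem_compact hK hμ (ContinuousOn.mul (by fun_prop)
      (hφc.comp (by fun_prop) fun x hx => ?_))
    simpa using hmem 0 x hx
  have hF0 : ∀ x, F' 0 x = x i * φ (x i) - x j ^ 2 * φ' (x i) := by
    intro x
    simp only [hF'def, Real.cos_zero, Real.sin_zero]
    simp only [one_mul, zero_mul, add_zero, neg_zero, zero_add, zero_sub]
    ring
  simp only [hF0] at heq
  rw [integral_sub hint2 hint1] at heq
  linarith

/-- The law of the `i`-th coordinate of a uniform point of the unit sphere. -/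
noncomputable def sphereMarginal {d : ℕ} (i : Fin d) : Measure ℝ :=
  (sphereUniform d).map (fun x => x i)

theorem map_inner_sphereUniform {d : ℕ} (i : Fin d) (v : EuclideanSpace ℝ (Fin d)) :
    (sphereUniform d).map (fun x => inner ℝ v x) =
      (sphereMarginal i).map (fun c => ‖v‖ * c) := by
  unfold sphereMarginal
  have hw : ‖v‖ = ‖(‖v‖ • EuclideanSpace.single i (1 : ℝ) : EuclideanSpace ℝ (Fin d))‖ := by
    simp [norm_smul]
  set L := (Submodule.span ℝ {v - ‖v‖ • EuclideanSpace.single i (1 : ℝ)})ᗮ.reflection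
  have hL : L v = ‖v‖ • EuclideanSpace.single i (1 : ℝ) := Submodule.reflection_sub hw
  have h : (fun x => inner ℝ v x) = (fun x : EuclideanSpace ℝ (Fin d) => ‖v‖ * x i) ∘ L := by
    ext x
    rw [← L.inner_map_map v x, hL]
    simp [inner_smul_left, EuclideanSpace.inner_single_left]
  rw [h, ← Measure.map_map (by fun_prop) L.continuous.measurable,
    sphereUniform_map_linearIsometryEquiv, Measure.map_map (by fun_prop) (by fun_prop)]
  rfl

theorem isSphereMarginal_sphereMarginal {d : ℕ} (i : Fin d) :
    IsSphereMarginal d (sphereMarginal i) := by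
  unfold sphereMarginal
  have : IsProbabilityMeasure (sphereUniform d) := isProbabilityMeasure_sphereUniform i.pos
  have hm : Measurable (fun x : EuclideanSpace ℝ (Fin d) => x i) := by fun_prop
  have hprob := Measure.isProbabilityMeasure_map (μ := sphereUniform d) hm.aemeasurable
  have hmem : ∀ᵐ x ∂(sphereUniform d), x i ∈ Set.Icc (-1 : ℝ) 1 := by
    filter_upwards [norm_eq_one_ae_sphereUniform d] with x hx
    rw [Set.mem_Icc, ← abs_le, ← Real.norm_eq_abs, ← hx]
    exact PiLp.norm_apply_le x i
  have hmem' : ∀ᵐ c ∂((sphereUniform d).map (fun x => x i)), c ∈ Set.Icc (-1 : ℝ) 1 := by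
    exact (ae_map_iff (p := fun c : ℝ => c ∈ Set.Icc (-1 : ℝ) 1) hm.aemeasurable
      measurableSet_Icc).2 hmem
  refine ⟨hprob, hmem', ?_, ?_⟩
  · rw [Measure.map_map (by fun_prop) hm]
    conv_rhs => rw [← sphereUniform_map_linearIsometryEquiv d (LinearIsometryEquiv.neg ℝ)]
    rw [Measure.map_map hm (LinearIsometryEquiv.continuous _).measurable]
    rfl
  · intro φ φ' hφ hφ'
    have hφc : ContinuousOn φ (Set.Icc (-1) 1) :=
      fun w hw => (hφ w hw).continuousAt.continuousWithinAt
    have hi1 : ContinuousOn (fun c => (1 - c ^ 2) * φ' c) (Set.Icc (-1) 1) := by fun_prop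
    have hi2 : ContinuousOn (fun c => c * φ c) (Set.Icc (-1) 1) := by fun_prop
    rw [integral_map hm.aemeasurable
        (hi1.integrable_of_ae_mem_compact isCompact_Icc hmem').aestronglyMeasurable,
      integral_map hm.aemeasurable
        (hi2.integrable_of_ae_mem_compact isCompact_Icc hmem').aestronglyMeasurable]
    have hint : ∀ j, Integrable (fun x : EuclideanSpace ℝ (Fin d) => x j ^ 2 * φ' (x i))
        (sphereUniform d) := by
      intro j
      have hK : ∀ᵐ x ∂(sphereUniform d), x ∈ Metric.sphere (0 : EuclideanSpace ℝ (Fin d)) 1 := by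
        filter_upwards [norm_eq_one_ae_sphereUniform d] with x hx
        simpa using hx
      refine ContinuousOn.integrable_of_ae_mem_compact (isCompact_sphere _ _) hK
        (ContinuousOn.mul (by fun_prop) (hφ'.comp (by fun_prop) fun x hx => ?_))
      rw [Set.mem_Icc, ← abs_le, ← Real.norm_eq_abs, ← mem_sphere_zero_iff_norm.1 hx]
      exact PiLp.norm_apply_le x i
    calc ∫ x, (1 - x i ^ 2) * φ' (x i) ∂(sphereUniform d)
        = ∫ x, ∑ j ∈ Finset.univ.erase i, x j ^ 2 * φ' (x i) ∂(sphereUniform d) := by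
          refine integral_congr_ae ?_
          filter_upwards [norm_eq_one_ae_sphereUniform d] with x hx
          have h1 : ‖x‖ ^ 2 = 1 := by rw [hx]; norm_num
          rw [EuclideanSpace.norm_sq_eq] at h1
          simp only [Real.norm_eq_abs, sq_abs] at h1
          rw [← Finset.sum_mul, ← h1, ← Finset.add_sum_erase _ _ (Finset.mem_univ i),
            add_sub_cancel_left]
      _ = ∑ j ∈ Finset.univ.erase i, ∫ x, x i * φ (x i) ∂(sphereUniform d) := by
          rw [integral_finsetSum _ fun j _ => hint j]
          refine Finset.sum_congr rfl fun j hj => ?_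
          exact stein_coordinate_sphereUniform (Finset.ne_of_mem_erase hj).symm hφ hφ'
      _ = _ := by
          rw [Finset.sum_const, Finset.card_erase_of_mem (Finset.mem_univ i), Finset.card_univ,
            Fintype.card_fin, nsmul_eq_mul, Nat.cast_sub i.pos, Nat.cast_one]

/-- `IsEPD d G k` is the Euler–Poisson–Darboux relation `r G'' + (d - 1) G' = 4 r k`
in divergence form. In the variable `y = r ^ 2` it reads `y h'' + (d / 2) h' = k`. -/
def IsEPD (d : ℕ) (G k : ℝ → ℝ) : Prop :=
  ∃ G₁ : ℝ → ℝ, (∀ r, HasDerivAt G (G₁ r) r) ∧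
    ∀ r, HasDerivAt (fun r => r ^ (d - 1) * G₁ r) (4 * r ^ (d - 1) * k r) r

namespace IsEPD

variable {d : ℕ} {G G' k k' l : ℝ → ℝ}

theorem sub (h : IsEPD d G k) (h' : IsEPD d G' k') :
    IsEPD d (fun r => G r - G' r) (fun r => k r - k' r) := by
  obtain ⟨G₁, h1, h2⟩ := h
  obtain ⟨G₁', h1', h2'⟩ := h'
  refine ⟨fun r => G₁ r - G₁' r, fun r => (h1 r).sub (h1' r), fun r => ?_⟩
  have := (h2 r).sub (h2' r)
  simp only [mul_sub]
  exact this

theorem const_mul (c : ℝ) (h : IsEPD d G k) :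
    IsEPD d (fun r => c * G r) (fun r => c * k r) := by
  obtain ⟨G₁, h1, h2⟩ := h
  refine ⟨fun r => c * G₁ r, fun r => (h1 r).const_mul c, fun r => ?_⟩
  have := (h2 r).const_mul c
  simp only [mul_left_comm _ c]
  exact this

theorem continuous (h : IsEPD d G k) : Continuous G := by
  obtain ⟨G₁, h1, -⟩ := h
  exact continuous_iff_continuousAt.2 fun r => (h1 r).continuousAt

theorem comp_sq (hd : 2 ≤ d) {q q₁ q₂ : ℝ → ℝ} (h1 : ∀ t, 0 ≤ t → HasDerivAt q (q₁ t) t)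
    (h2 : ∀ t, 0 ≤ t → HasDerivAt q₁ (q₂ t) t) :
    IsEPD d (fun r => q (r ^ 2)) (fun r => r ^ 2 * q₂ (r ^ 2) + d / 2 * q₁ (r ^ 2)) := by
  have hsq : ∀ r : ℝ, HasDerivAt (fun r : ℝ => r ^ 2) (2 * r) r := fun r => by
    simpa using hasDerivAt_pow 2 r
  have hc1 : ∀ r, HasDerivAt (fun r => q (r ^ 2)) (q₁ (r ^ 2) * (2 * r)) r := fun r =>
    HasDerivAt.comp (h := fun r : ℝ => r ^ 2) (h₂ := q) r (h1 _ (sq_nonneg r)) (hsq r)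
  have hc2 : ∀ r, HasDerivAt (fun r => q₁ (r ^ 2)) (q₂ (r ^ 2) * (2 * r)) r := fun r =>
    HasDerivAt.comp (h := fun r : ℝ => r ^ 2) (h₂ := q₁) r (h2 _ (sq_nonneg r)) (hsq r)
  refine ⟨fun r => q₁ (r ^ 2) * (2 * r), hc1, fun r => ?_⟩
  obtain ⟨k, rfl⟩ := Nat.exists_eq_add_of_le' hd
  have h := ((hasDerivAt_pow (k + 2) r).mul (hc2 r)).const_mul 2
  have he : (fun r : ℝ => r ^ (k + 2 - 1) * (q₁ (r ^ 2) * (2 * r))) =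
      fun r => 2 * (r ^ (k + 2) * q₁ (r ^ 2)) := by
    ext r
    rw [show k + 2 - 1 = k + 1 by omega]
    ring
  rw [he]
  refine h.congr_deriv ?_
  simp only [show k + 2 - 1 = k + 1 by omega]
  push_cast
  ring

/-- If `G` is obtained by applying the inverse of `y ∂² + (d / 2) ∂` twice to a nonnegative
function, then `G` is convex as a function of `y = r ^ 2`. -/
theorem convexOn_comp_sqrt (hd : 2 ≤ d) (hG : IsEPD d G k) (hk : IsEPD d k l)
    (hl : ∀ r, 0 < r → 0 ≤ l r) : ConvexOn ℝ (Set.Ici 0) (fun y => G √y) := by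
  have hGc := hG.continuous
  obtain ⟨G₁, hG1, hG2⟩ := hG
  obtain ⟨k₁, hk1, hk2⟩ := hk
  have hd1 : d - 1 ≠ 0 := by omega
  have hd0 : d ≠ 0 := by omega
  have hpd : ∀ r : ℝ, r ^ d = r ^ (d - 1) * r := fun r => by
    rw [← pow_succ]; congr 1; omega
  have hk1nn : ∀ r, 0 < r → 0 ≤ k₁ r := by
    intro r hr
    have hmono : MonotoneOn (fun r => r ^ (d - 1) * k₁ r) (Set.Ici 0) := by
      refine monotoneOn_of_deriv_nonneg (convex_Ici 0)
        (fun x _ => (hk2 x).continuousAt.continuousWithinAt)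
        (fun x _ => (hk2 x).differentiableAt.differentiableWithinAt) fun x hx => ?_
      rw [interior_Ici, Set.mem_Ioi] at hx
      rw [(hk2 x).deriv]
      have := hl x hx
      positivity
    have h := hmono (Set.mem_Ici.2 le_rfl) (Set.mem_Ici.2 hr.le) hr.le
    simp only [zero_pow hd1, zero_mul] at h
    exact nonneg_of_mul_nonneg_right h (by positivity)
  have hW : ∀ r, 0 < r → 0 ≤ 4 * (r ^ d * k r) - d * (r ^ (d - 1) * G₁ r) := by
    have hder : ∀ r, HasDerivAt (fun r => 4 * (r ^ d * k r) - d * (r ^ (d - 1) * G₁ r))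
        (4 * (r ^ d * k₁ r)) r := fun r =>
      ((((hasDerivAt_pow d r).mul (hk1 r)).const_mul 4).sub
        ((hG2 r).const_mul (d : ℝ))).congr_deriv (by ring)
    intro r hr
    have hmono : MonotoneOn (fun r => 4 * (r ^ d * k r) - d * (r ^ (d - 1) * G₁ r))
        (Set.Ici 0) := by
      refine monotoneOn_of_deriv_nonneg (convex_Ici 0)
        (fun x _ => (hder x).continuousAt.continuousWithinAt)
        (fun x _ => (hder x).differentiableAt.differentiableWithinAt) fun x hx => ?_
      rw [interior_Ici, Set.mem_Ioi] at hx
      rw [(hder x).deriv]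
      have := hk1nn x hx
      positivity
    have h := hmono (Set.mem_Ici.2 le_rfl) (Set.mem_Ici.2 hr.le) hr.le
    simpa only [zero_pow hd1, zero_pow hd0, zero_mul, mul_zero, sub_zero] using h
  have hM : MonotoneOn (fun r => r ^ (d - 1) * G₁ r / r ^ d) (Set.Ioi 0) := by
    have hder : ∀ r, 0 < r → HasDerivAt (fun r => r ^ (d - 1) * G₁ r / r ^ d)
        ((4 * r ^ (d - 1) * k r * r ^ d - r ^ (d - 1) * G₁ r * (d * r ^ (d - 1))) /
          (r ^ d) ^ 2) r := fun r hr => (hG2 r).div (hasDerivAt_pow d r) (by positivity)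
    refine monotoneOn_of_deriv_nonneg (convex_Ioi 0)
      (fun x hx => (hder x hx).continuousAt.continuousWithinAt)
      (fun x hx => (hder x (by simpa using hx)).differentiableAt.differentiableWithinAt)
      fun x hx => ?_
    rw [interior_Ioi, Set.mem_Ioi] at hx
    rw [(hder x hx).deriv]
    have := hW x hx
    refine div_nonneg ?_ (by positivity)
    have h2 : 0 ≤ x ^ (d - 1) * (4 * (x ^ d * k x) - d * (x ^ (d - 1) * G₁ x)) := by positivity
    linarith
  have hder : ∀ y, 0 < y → HasDerivAt (fun y => G √y) (G₁ √y * (1 / (2 * √y))) y := fun y hy =>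
    (hG1 _).comp y (Real.hasDerivAt_sqrt hy.ne')
  refine MonotoneOn.convexOn_of_deriv (convex_Ici 0) (hGc.comp Real.continuous_sqrt).continuousOn
    (fun y hy => ?_) ?_
  · rw [interior_Ici, Set.mem_Ioi] at hy
    exact (hder y hy).differentiableAt.differentiableWithinAt
  · rw [interior_Ici]
    intro y hy z hz hyz
    have hy' := Real.sqrt_pos.2 hy
    have hz' := Real.sqrt_pos.2 hz
    rw [(hder y hy).deriv, (hder z hz).deriv]
    have h := hM hy' hz' (Real.sqrt_le_sqrt hyz)
    have hh : ∀ r, 0 < r → r ^ (d - 1) * G₁ r / r ^ d = G₁ r / r := fun r hr => by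
      rw [hpd, mul_div_mul_left _ _ (by positivity)]
    simp only [hh _ hy', hh _ hz'] at h
    have e : ∀ r : ℝ, G₁ r * (1 / (2 * r)) = G₁ r / r / 2 := fun r => by
      rw [one_div, mul_inv]; ring
    rw [e, e]
    linarith

end IsEPD

/-- The average of `f (‖v + r ξ‖ ^ 2)` over a uniform point `ξ` of the unit sphere, in terms of
`ρ = ‖v‖` and of the law `ν` of a coordinate of `ξ`. -/
noncomputable def radialMean (ν : Measure ℝ) (f : ℝ → ℝ) (ρ r : ℝ) : ℝ :=
  ∫ c, f (ρ ^ 2 + r ^ 2 + 2 * ρ * r * c) ∂ν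

theorem sq_add_sq_add_nonneg {c : ℝ} (hc : c ∈ Set.Icc (-1 : ℝ) 1) (ρ r : ℝ) :
    0 ≤ ρ ^ 2 + r ^ 2 + 2 * ρ * r * c := by
  have hc2 : c ^ 2 ≤ 1 := by nlinarith [hc.1, hc.2]
  nlinarith [sq_nonneg (ρ + r * c), mul_nonneg (sq_nonneg r) (sub_nonneg.2 hc2)]

namespace IsSphereMarginal

variable {d : ℕ} {ν : Measure ℝ}

theorem integrable (hν : IsSphereMarginal d ν) {g : ℝ → ℝ}
    (hg : ContinuousOn g (Set.Icc (-1) 1)) : Integrable g ν :=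
  have := hν.prob
  hg.integrable_of_ae_mem_compact isCompact_Icc hν.mem_Icc

theorem integral_comp_neg (hν : IsSphereMarginal d ν) (g : ℝ → ℝ) :
    ∫ c, g (-c) ∂ν = ∫ c, g c ∂ν := by
  have : MeasurePreserving (fun c : ℝ => -c) ν ν := ⟨measurable_neg, hν.map_neg⟩
  exact this.integral_comp (MeasurableEquiv.neg ℝ).measurableEmbedding g

theorem integral_id (hν : IsSphereMarginal d ν) : ∫ c, c ∂ν = 0 := by
  have := hν.integral_comp_neg fun c => c
  rw [integral_neg] at this
  linarith

theorem integral_pow_three (hν : IsSphereMarginal d ν) : ∫ c, c ^ 3 ∂ν = 0 := by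
  have := hν.integral_comp_neg fun c => c ^ 3
  simp only [Odd.neg_pow (by decide : Odd 3)] at this
  rw [integral_neg] at this
  linarith

theorem integral_sq (hd : d ≠ 0) (hν : IsSphereMarginal d ν) : ∫ c, c ^ 2 ∂ν = 1 / d := by
  have := hν.prob
  have h := hν.stein (fun c => c) (fun _ => 1) (fun w _ => hasDerivAt_id w) continuousOn_const
  have hi : Integrable (fun c : ℝ => c ^ 2) ν := hν.integrable (by fun_prop)
  simp only [mul_one, ← pow_two] at h
  rw [integral_sub (integrable_const _) hi, integral_const, probReal_univ, one_smul] at h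
  have hd' : (d : ℝ) ≠ 0 := by exact_mod_cast hd
  field_simp
  linarith

theorem integral_pow_four_le (hd : d ≠ 0) (hν : IsSphereMarginal d ν) :
    ∫ c, c ^ 4 ∂ν ≤ 1 / d := by
  rw [← hν.integral_sq hd]
  refine integral_mono_ae (hν.integrable (by fun_prop)) (hν.integrable (by fun_prop)) ?_
  filter_upwards [hν.mem_Icc] with c hc
  have hc2 : c ^ 2 ≤ 1 := by nlinarith [hc.1, hc.2]
  nlinarith [sq_nonneg c]

theorem integral_comp_le_of_convexOn (hν : IsSphereMarginal d ν) {h : ℝ → ℝ}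
    (hh : ConvexOn ℝ (Set.Ici 0) h) (hc : ContinuousOn h (Set.Ici 0)) {σ b b' : ℝ}
    (hb : |b| ≤ |b'|) (hb' : |b'| ≤ σ) :
    ∫ c, h (σ + b * c) ∂ν ≤ ∫ c, h (σ + b' * c) ∂ν := by
  rcases eq_or_ne b' 0 with rfl | hb0
  · rw [abs_zero, abs_nonpos_iff] at hb
    rw [hb]
  have hmem : ∀ c ∈ Set.Icc (-1 : ℝ) 1, ∀ u, |u| ≤ |b'| → 0 ≤ σ + u * c := by
    intro c hc u hu
    have h1 : |u * c| ≤ σ := by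
      rw [abs_mul]
      have := abs_le.2 hc
      nlinarith [abs_nonneg u, abs_nonneg c]
    linarith [(abs_le.1 h1).1]
  have hint : ∀ u, |u| ≤ |b'| → Integrable (fun c => h (σ + u * c)) ν := fun u hu =>
    hν.integrable (hc.comp (by fun_prop) fun c hc => hmem c hc u hu)
  set θ := b / b' with hθ
  have hθ1 : |θ| ≤ 1 := by
    rw [hθ, abs_div]
    exact (div_le_one (abs_pos.2 hb0)).2 hb
  have hbθ : b = θ * b' := by rw [hθ]; field_simp
  have hsymm : ∫ c, h (σ + -b' * c) ∂ν = ∫ c, h (σ + b' * c) ∂ν := by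
    rw [← hν.integral_comp_neg fun c => h (σ + b' * c)]
    simp
  calc ∫ c, h (σ + b * c) ∂ν
      ≤ ∫ c, ((1 + θ) / 2 * h (σ + b' * c) + (1 - θ) / 2 * h (σ + -b' * c)) ∂ν := by
        refine integral_mono_ae (hint b hb) (((hint b' le_rfl).const_mul _).add
          ((hint (-b') (abs_neg b').le).const_mul _)) ?_
        filter_upwards [hν.mem_Icc] with c hc
        have := hh.2 (hmem c hc b' le_rfl) (hmem c hc (-b') (abs_neg b').le)
          (show 0 ≤ (1 + θ) / 2 by linarith [(abs_le.1 hθ1).1])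
          (show 0 ≤ (1 - θ) / 2 by linarith [(abs_le.1 hθ1).2]) (by ring)
        simp only [smul_eq_mul] at this
        convert this using 2
        rw [hbθ]
        ring
    _ = ∫ c, h (σ + b' * c) ∂ν := by
        rw [integral_add ((hint b' le_rfl).const_mul _)
          ((hint (-b') (abs_neg b').le).const_mul _), integral_const_mul, integral_const_mul, hsymm]
        ring

theorem continuousOn_comp_radial {f : ℝ → ℝ} (hf : ContinuousOn f (Set.Ici 0)) (ρ r : ℝ) :
    ContinuousOn (fun c => f (ρ ^ 2 + r ^ 2 + 2 * ρ * r * c)) (Set.Icc (-1) 1) :=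
  hf.comp (by fun_prop) fun _ hc => sq_add_sq_add_nonneg hc ρ r

/-- Averaging over spheres intertwines the Laplacian on radial functions with the
Euler–Poisson–Darboux operator. -/
theorem isEPD_radialMean (hd : 2 ≤ d) (hν : IsSphereMarginal d ν) {f f₁ f₂ : ℝ → ℝ}
    (h1 : ∀ t, 0 ≤ t → HasDerivAt f (f₁ t) t) (h2 : ∀ t, 0 ≤ t → HasDerivAt f₁ (f₂ t) t)
    (h2c : ContinuousOn f₂ (Set.Ici 0)) (ρ : ℝ) :
    IsEPD d (radialMean ν f ρ) (radialMean ν (fun t => t * f₂ t + d / 2 * f₁ t) ρ) := by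
  have := hν.prob
  have hfc : ContinuousOn f (Set.Ici 0) := fun t ht => (h1 t ht).continuousAt.continuousWithinAt
  have h1c : ContinuousOn f₁ (Set.Ici 0) := fun t ht => (h2 t ht).continuousAt.continuousWithinAt
  have hA : ∀ r c, HasDerivAt (fun r => ρ ^ 2 + r ^ 2 + 2 * ρ * r * c) (2 * r + 2 * ρ * c) r :=
    fun r c => ((((hasDerivAt_pow 2 r).const_add (ρ ^ 2)).add
      (((hasDerivAt_id r).const_mul (2 * ρ)).mul_const c))).congr_deriv (by simp)
  have hmaps : Set.MapsTo (fun q : ℝ × ℝ => ρ ^ 2 + q.1 ^ 2 + 2 * ρ * q.1 * q.2)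
      (Set.univ ×ˢ Set.Icc (-1) 1) (Set.Ici 0) := fun q hq => sq_add_sq_add_nonneg hq.2 ρ q.1
  have hAc : ContinuousOn (fun q : ℝ × ℝ => ρ ^ 2 + q.1 ^ 2 + 2 * ρ * q.1 * q.2)
      (Set.univ ×ˢ Set.Icc (-1) 1) := by fun_prop
  have hf1A := h1c.comp hAc hmaps
  have hf2A := h2c.comp hAc hmaps
  have hd1 : ∀ r, HasDerivAt (radialMean ν f ρ)
      (∫ c, f₁ (ρ ^ 2 + r ^ 2 + 2 * ρ * r * c) * (2 * r + 2 * ρ * c) ∂ν) r :=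
    hasDerivAt_integral_of_ae_mem_compact
      (F := fun r c => f (ρ ^ 2 + r ^ 2 + 2 * ρ * r * c))
      (F' := fun r c => f₁ (ρ ^ 2 + r ^ 2 + 2 * ρ * r * c) * (2 * r + 2 * ρ * c))
      isCompact_Icc hν.mem_Icc
      (fun r c hc => (h1 _ (sq_add_sq_add_nonneg hc ρ r)).comp r (hA r c))
      (fun r => continuousOn_comp_radial hfc ρ r) (hf1A.mul (by fun_prop))
  have hd2 : ∀ r, HasDerivAt
      (fun r => ∫ c, f₁ (ρ ^ 2 + r ^ 2 + 2 * ρ * r * c) * (2 * r + 2 * ρ * c) ∂ν)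
      (∫ c, (f₂ (ρ ^ 2 + r ^ 2 + 2 * ρ * r * c) * (2 * r + 2 * ρ * c) * (2 * r + 2 * ρ * c) +
        f₁ (ρ ^ 2 + r ^ 2 + 2 * ρ * r * c) * 2) ∂ν) r :=
    hasDerivAt_integral_of_ae_mem_compact
      (F := fun r c => f₁ (ρ ^ 2 + r ^ 2 + 2 * ρ * r * c) * (2 * r + 2 * ρ * c))
      (F' := fun r c => f₂ (ρ ^ 2 + r ^ 2 + 2 * ρ * r * c) * (2 * r + 2 * ρ * c) *
        (2 * r + 2 * ρ * c) + f₁ (ρ ^ 2 + r ^ 2 + 2 * ρ * r * c) * 2)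
      isCompact_Icc hν.mem_Icc
      (fun r c hc => ((h2 _ (sq_add_sq_add_nonneg hc ρ r)).comp r (hA r c)).mul
        ((((hasDerivAt_id r).const_mul 2).add_const (2 * ρ * c)).congr_deriv (by simp)))
      (fun r => (continuousOn_comp_radial h1c ρ r).mul (by fun_prop))
      (((hf2A.mul (by fun_prop)).mul (by fun_prop)).add (hf1A.mul (by fun_prop)))
  refine ⟨_, hd1, fun r => ?_⟩
  refine ((hasDerivAt_pow (d - 1) r).mul (hd2 r)).congr_deriv ?_
  have hst := hν.stein (fun w => f₁ (ρ ^ 2 + r ^ 2 + 2 * ρ * r * w))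
    (fun w => f₂ (ρ ^ 2 + r ^ 2 + 2 * ρ * r * w) * (2 * ρ * r))
    (fun w hw => (h2 _ (sq_add_sq_add_nonneg hw ρ r)).comp w
      ((((hasDerivAt_id w).const_mul (2 * ρ * r)).const_add (ρ ^ 2 + r ^ 2)).congr_deriv (by simp)))
    ((continuousOn_comp_radial h2c ρ r).mul continuousOn_const)
  unfold radialMean
  set u : ℝ → ℝ := fun c => f₁ (ρ ^ 2 + r ^ 2 + 2 * ρ * r * c) with hu
  set w : ℝ → ℝ := fun c => f₂ (ρ ^ 2 + r ^ 2 + 2 * ρ * r * c) with hw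
  have huc : ContinuousOn u (Set.Icc (-1) 1) := continuousOn_comp_radial h1c ρ r
  have hwc : ContinuousOn w (Set.Icc (-1) 1) := continuousOn_comp_radial h2c ρ r
  have i1 : Integrable u ν := hν.integrable huc
  have i2 : Integrable (fun c => c * u c) ν := hν.integrable (by fun_prop)
  have j0 : Integrable w ν := hν.integrable hwc
  have j1 : Integrable (fun c => c * w c) ν := hν.integrable (by fun_prop)
  have j2 : Integrable (fun c => c ^ 2 * w c) ν := hν.integrable (by fun_prop)
  have e0 : ∫ c, (1 - c ^ 2) * (w c * (2 * ρ * r)) ∂ν =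
      2 * ρ * r * (∫ c, w c ∂ν - ∫ c, c ^ 2 * w c ∂ν) := by
    rw [← integral_sub j0 j2, ← integral_const_mul]
    congr 1; ext c; ring
  have e1 : ∫ c, u c * (2 * r + 2 * ρ * c) ∂ν = 2 * r * ∫ c, u c ∂ν + 2 * ρ * ∫ c, c * u c ∂ν := by
    rw [← integral_const_mul, ← integral_const_mul, ← integral_add (i1.const_mul _) (i2.const_mul _)]
    congr 1; ext c; ring
  have e2 : ∫ c, (w c * (2 * r + 2 * ρ * c) * (2 * r + 2 * ρ * c) + u c * 2) ∂ν =
      4 * r ^ 2 * ∫ c, w c ∂ν + 8 * r * ρ * ∫ c, c * w c ∂ν + 4 * ρ ^ 2 * ∫ c, c ^ 2 * w c ∂ν +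
        2 * ∫ c, u c ∂ν := by
    simp only [← integral_const_mul]
    rw [← integral_add (j0.const_mul _) (j1.const_mul _),
      ← integral_add (hν.integrable (by fun_prop)) (j2.const_mul _),
      ← integral_add (hν.integrable (by fun_prop)) (i1.const_mul _)]
    congr 1; ext c; ring
  have e3 : ∫ c, ((ρ ^ 2 + r ^ 2 + 2 * ρ * r * c) * w c + d / 2 * u c) ∂ν =
      (ρ ^ 2 + r ^ 2) * ∫ c, w c ∂ν + 2 * ρ * r * ∫ c, c * w c ∂ν + d / 2 * ∫ c, u c ∂ν := by
    simp only [← integral_const_mul]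
    rw [← integral_add (j0.const_mul _) (j1.const_mul _),
      ← integral_add (hν.integrable (by fun_prop)) (i1.const_mul _)]
    congr 1; ext c; ring
  rw [e0] at hst
  rw [e1, e2, e3]
  obtain ⟨k, rfl⟩ := Nat.exists_eq_add_of_le' hd
  simp only [show k + 2 - 1 = k + 1 by omega, Nat.add_sub_cancel]
  push_cast at hst ⊢
  linear_combination (-2 * ρ * r ^ k) * hst

end IsSphereMarginal

theorem one_add_mul_sub_le_rpow_of_nonpos {a p : ℝ} (ha : 0 < a) (hp : p ≤ 0) :
    1 + p * (a - 1) ≤ a ^ p := by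
  rw [Real.rpow_def_of_pos ha]
  have h1 := Real.add_one_le_exp (Real.log a * p)
  have h2 := Real.log_le_sub_one_of_pos ha
  nlinarith

/-- The quadratic which touches `a ↦ a ^ m` from below at `t` and vanishes at `0`. -/
theorem quadratic_le_rpow {m t a : ℝ} (hm0 : 0 < m) (hm1 : m ≤ 1) (ht : 0 < t) (ha : 0 ≤ a) :
    (2 - m) * t ^ (m - 1) * a - (1 - m) * t ^ (m - 2) * a ^ 2 ≤ a ^ m := by
  rcases ha.eq_or_lt with rfl | ha
  · simp [Real.zero_rpow hm0.ne']
  have h := one_add_mul_sub_le_rpow_of_nonpos (div_pos ha ht) (sub_nonpos.2 hm1)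
  rw [Real.div_rpow ha.le ht.le, le_div_iff₀ (by positivity)] at h
  have e1 : a ^ m = a * a ^ (m - 1) := by
    rw [Real.rpow_sub_one ha.ne']; field_simp
  have e2 : t ^ (m - 2) = t ^ (m - 1) / t := by
    rw [← Real.rpow_sub_one ht.ne']; congr 1; ring
  rw [e1, e2]
  calc (2 - m) * t ^ (m - 1) * a - (1 - m) * (t ^ (m - 1) / t) * a ^ 2
      = a * ((1 + (m - 1) * (a / t - 1)) * t ^ (m - 1)) := by field_simp; ring
    _ ≤ a * a ^ (m - 1) := by gcongr

theorem convexOn_Ici_of_hasDerivAt2_nonneg {f f₁ f₂ : ℝ → ℝ}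
    (h1 : ∀ y, 0 ≤ y → HasDerivAt f (f₁ y) y) (h2 : ∀ y, 0 ≤ y → HasDerivAt f₁ (f₂ y) y)
    (h : ∀ y, 0 < y → 0 ≤ f₂ y) : ConvexOn ℝ (Set.Ici 0) f := by
  have hmono : MonotoneOn f₁ (Set.Ici 0) := by
    refine monotoneOn_of_deriv_nonneg (convex_Ici 0)
      (fun x hx => (h2 x hx).continuousAt.continuousWithinAt) ?_ ?_ <;>
    · intro x hx
      rw [interior_Ici, Set.mem_Ioi] at hx
      first
        | exact (h2 x hx.le).differentiableAt.differentiableWithinAt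
        | (rw [(h2 x hx.le).deriv]; exact h x hx)
  refine MonotoneOn.convexOn_of_deriv (convex_Ici 0)
    (fun x hx => (h1 x hx).continuousAt.continuousWithinAt)
    (fun x hx => ?_) ?_
  · rw [interior_Ici, Set.mem_Ioi] at hx
    exact (h1 x hx.le).differentiableAt.differentiableWithinAt
  · rw [interior_Ici]
    intro y hy z hz hyz
    rw [(h1 y (Set.mem_Ioi.1 hy).le).deriv, (h1 z (Set.mem_Ioi.1 hz).le).deriv]
    exact hmono (Set.mem_Ioi.1 hy).le (Set.mem_Ioi.1 hz).le hyz

theorem isEPD_quartic {d : ℕ} (hd : 2 ≤ d) (q₁ q₂ q₃ q₄ : ℝ) :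
    IsEPD d (fun r => q₁ * r ^ 2 + q₂ * (r ^ 2) ^ 2 + q₃ * (r ^ 2) ^ 3 + q₄ * (r ^ 2) ^ 4)
      (fun r => d / 2 * q₁ + 2 * (1 + d / 2) * q₂ * r ^ 2 + 3 * (2 + d / 2) * q₃ * (r ^ 2) ^ 2 +
        4 * (3 + d / 2) * q₄ * (r ^ 2) ^ 3) := by
  have h := IsEPD.comp_sq hd
    (q := fun t => q₁ * t + q₂ * t ^ 2 + q₃ * t ^ 3 + q₄ * t ^ 4)
    (q₁ := fun t => q₁ + q₂ * (2 * t) + q₃ * (3 * t ^ 2) + q₄ * (4 * t ^ 3))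
    (q₂ := fun t => 2 * q₂ + q₃ * (6 * t) + q₄ * (12 * t ^ 2))
    (fun t _ => ((((((hasDerivAt_id t).const_mul q₁)).add ((hasDerivAt_pow 2 t).const_mul q₂)).add
      ((hasDerivAt_pow 3 t).const_mul q₃)).add
      ((hasDerivAt_pow 4 t).const_mul q₄)).congr_deriv (by simp))
    (fun t _ => ((((((hasDerivAt_id t).const_mul 2).const_mul q₂).const_add q₁).add
      (((hasDerivAt_pow 2 t).const_mul 3).const_mul q₃)).add
      (((hasDerivAt_pow 3 t).const_mul 4).const_mul q₄)).congr_deriv (by simp; ring))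
  convert h using 2 with r
  ring

/-- If two applications of the Euler–Poisson–Darboux operator to `G` dominate those to a quartic,
then `G` minus the quartic is convex in `y = r ^ 2`. -/
theorem IsEPD.convexOn_sub_quartic {d : ℕ} (hd : 2 ≤ d) {G k l : ℝ → ℝ} (hG : IsEPD d G k)
    (hk : IsEPD d k l) {q₂ q₃ q₄ : ℝ}
    (hl : ∀ r, d / 2 * (2 * (1 + d / 2) * q₂) +
      2 * (1 + d / 2) * (3 * (2 + d / 2) * q₃) * r ^ 2 +
      3 * (2 + d / 2) * (4 * (3 + d / 2) * q₄) * (r ^ 2) ^ 2 ≤ l r) :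
    ConvexOn ℝ (Set.Ici 0) (fun y => G √y - (q₂ * y ^ 2 + q₃ * y ^ 3 + q₄ * y ^ 4)) := by
  have h1 := isEPD_quartic hd 0 q₂ q₃ q₄
  have h2 := isEPD_quartic hd (2 * (1 + d / 2) * q₂) (3 * (2 + d / 2) * q₃)
    (4 * (3 + d / 2) * q₄) 0
  have he : (fun r : ℝ => d / 2 * 0 + 2 * (1 + d / 2) * q₂ * r ^ 2 +
      3 * (2 + d / 2) * q₃ * (r ^ 2) ^ 2 + 4 * (3 + d / 2) * q₄ * (r ^ 2) ^ 3) =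
      fun r => 2 * (1 + d / 2) * q₂ * r ^ 2 + 3 * (2 + d / 2) * q₃ * (r ^ 2) ^ 2 +
        4 * (3 + d / 2) * q₄ * (r ^ 2) ^ 3 + 0 * (r ^ 2) ^ 4 := by
    ext r; ring
  rw [← he] at h2
  refine ((hG.sub h1).convexOn_comp_sqrt hd (hk.sub h2) fun r _ => ?_).congr fun y hy => ?_
  · linarith [hl r]
  · simp only [Real.sq_sqrt (Set.mem_Ici.1 hy)]
    ring

/-- The average of `(‖v + r ξ‖ ^ 2 + ε) ^ γ` over a uniform point `ξ` of the unit sphere. -/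
noncomputable def powMean (ν : Measure ℝ) (ε γ ρ r : ℝ) : ℝ :=
  radialMean ν (fun t => (t + ε) ^ γ) ρ r

namespace IsSphereMarginal

variable {d : ℕ} {ν : Measure ℝ} {ε β γ : ℝ}

theorem continuousOn_add_rpow (h : 0 < ε ∨ (0 ≤ ε ∧ 0 ≤ γ)) :
    ContinuousOn (fun t : ℝ => (t + ε) ^ γ) (Set.Ici 0) := by
  refine ContinuousOn.rpow_const (by fun_prop) fun t ht => ?_
  rcases h with h | h
  · exact Or.inl (by have := Set.mem_Ici.1 ht; positivity)
  · exact Or.inr h.2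

theorem integrable_powMean (hν : IsSphereMarginal d ν) (h : 0 < ε ∨ (0 ≤ ε ∧ 0 ≤ γ)) (ρ r : ℝ) :
    Integrable (fun c => (ρ ^ 2 + r ^ 2 + 2 * ρ * r * c + ε) ^ γ) ν :=
  hν.integrable (continuousOn_comp_radial (continuousOn_add_rpow h) ρ r)

theorem isEPD_powMean (hd : 2 ≤ d) (hν : IsSphereMarginal d ν) (h : 0 < ε ∨ (0 ≤ ε ∧ 2 ≤ γ))
    (ρ : ℝ) :
    IsEPD d (powMean ν ε γ ρ) (fun r => γ * (γ + d / 2 - 1) * powMean ν ε (γ - 1) ρ r -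
      γ * (γ - 1) * ε * powMean ν ε (γ - 2) ρ r) := by
  have hε : 0 ≤ ε := h.elim le_of_lt And.left
  have hder : ∀ δ : ℝ, 0 < ε ∨ 1 ≤ δ → ∀ t, 0 ≤ t →
      HasDerivAt (fun t : ℝ => (t + ε) ^ δ) (δ * (t + ε) ^ (δ - 1)) t := by
    intro δ hδ t ht
    refine (((hasDerivAt_id t).add_const ε).rpow_const (p := δ) ?_).congr_deriv (by simp)
    exact hδ.imp (fun h => by simp only [id]; positivity) id
  have h1 := hder γ (h.imp_right fun h => by linarith [h.2])
  have h2 : ∀ t, 0 ≤ t → HasDerivAt (fun t : ℝ => γ * (t + ε) ^ (γ - 1))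
      (γ * (γ - 1) * (t + ε) ^ (γ - 2)) t := fun t ht =>
    ((hder (γ - 1) (h.imp_right fun h => by linarith [h.2]) t ht).const_mul γ).congr_deriv
      (by rw [show γ - 1 - 1 = γ - 2 by ring, mul_assoc])
  have hc := (continuousOn_add_rpow (ε := ε) (γ := γ - 2)
    (h.imp_right fun h => ⟨h.1, by linarith [h.2]⟩)).const_mul (γ * (γ - 1))
  have key := hν.isEPD_radialMean hd h1 h2 hc ρ
  suffices hk : (fun r => γ * (γ + d / 2 - 1) * powMean ν ε (γ - 1) ρ r -
      γ * (γ - 1) * ε * powMean ν ε (γ - 2) ρ r) = radialMean ν (fun t =>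
        t * (γ * (γ - 1) * (t + ε) ^ (γ - 2)) + d / 2 * (γ * (t + ε) ^ (γ - 1))) ρ by
    rw [hk]
    exact key
  ext r
  unfold powMean radialMean
  rw [← integral_const_mul, ← integral_const_mul,
    ← integral_sub ((hν.integrable_powMean (h.imp_right fun h => ⟨h.1, by linarith [h.2]⟩)
      ρ r).const_mul _) ((hν.integrable_powMean (h.imp_right fun h => ⟨h.1, by linarith [h.2]⟩)
      ρ r).const_mul _)]
  refine integral_congr_ae ?_
  filter_upwards [hν.mem_Icc] with c hc
  have hA := sq_add_sq_add_nonneg hc ρ r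
  set A := ρ ^ 2 + r ^ 2 + 2 * ρ * r * c
  have hmul : (A + ε) ^ (γ - 1) = (A + ε) * (A + ε) ^ (γ - 2) := by
    rcases (add_nonneg hA hε).eq_or_lt with h0 | h0
    · have hγ : 2 ≤ γ := h.elim (fun h => by linarith) And.right
      rw [← h0, zero_mul, Real.zero_rpow (by linarith)]
    · have := Real.rpow_sub_one h0.ne' (γ - 1)
      rw [show γ - 1 - 1 = γ - 2 by ring] at this
      rw [this]
      field_simp
  rw [hmul]
  ring

end IsSphereMarginal

/-- `G ρ √y` exceeds a quartic in `y`, with the displayed coefficients, by a convex function. -/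
def HasQuarticMinorant (G : ℝ → ℝ → ℝ) (a₀ a₁ a₂ b₀ b₁ c₀ : ℝ) : Prop :=
  ∀ ρ, ConvexOn ℝ (Set.Ici 0) (fun y => G ρ √y -
    ((a₀ + a₁ * ρ ^ 2 + a₂ * ρ ^ 4) * y ^ 2 + (b₀ + b₁ * ρ ^ 2) * y ^ 3 + c₀ * y ^ 4))

/-- The coefficient of `|x| ^ (2 * β - 4)` in a sixteenth of the bilaplacian of `|x| ^ (2 * β)` in
dimension `d`. -/
noncomputable def bilaplaceCoeff (d : ℕ) (β : ℝ) : ℝ :=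
  β * (β - 1) * (β + d / 2 - 1) * (β + d / 2 - 2)

theorem bilaplaceCoeff_nonneg {d : ℕ} {β : ℝ} (hd : 2 ≤ d) (hβ : 1 ≤ β) : 0 ≤ bilaplaceCoeff d β := by
  have : (2 : ℝ) ≤ d := by exact_mod_cast hd
  have h1 : 0 ≤ β - 1 := by linarith
  have h2 : 0 ≤ β + d / 2 - 1 := by linarith
  have h3 : 0 ≤ β + d / 2 - 2 := by linarith
  unfold bilaplaceCoeff
  positivity

namespace IsSphereMarginal

variable {d : ℕ} {ν : Measure ℝ} {ε β γ : ℝ}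

theorem powMean_nonneg (hν : IsSphereMarginal d ν) (hε : 0 ≤ ε) (ρ r : ℝ) :
    0 ≤ powMean ν ε γ ρ r := by
  refine integral_nonneg_of_ae ?_
  filter_upwards [hν.mem_Icc] with c hc
  exact Real.rpow_nonneg (add_nonneg (sq_add_sq_add_nonneg hc ρ r) hε) _

theorem powMean_le_rpow (hν : IsSphereMarginal d ν) (hε : 0 < ε) (hγ : γ ≤ 0) (ρ r : ℝ) :
    powMean ν ε γ ρ r ≤ ε ^ γ := by
  have := hν.prob
  calc powMean ν ε γ ρ r ≤ ∫ _, ε ^ γ ∂ν := by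
        refine integral_mono_ae (hν.integrable_powMean (Or.inl hε) ρ r) (integrable_const _) ?_
        filter_upwards [hν.mem_Icc] with c hc
        exact Real.rpow_le_rpow_of_nonpos hε
          (le_add_of_nonneg_left (sq_add_sq_add_nonneg hc ρ r)) hγ
    _ = ε ^ γ := by simp

theorem integral_radial (hν : IsSphereMarginal d ν) (ρ r : ℝ) :
    ∫ c, (ρ ^ 2 + r ^ 2 + 2 * ρ * r * c) ∂ν = ρ ^ 2 + r ^ 2 := by
  have := hν.prob
  rw [integral_add (integrable_const _) (hν.integrable (by fun_prop)), integral_const_mul,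
    hν.integral_id]
  simp

theorem integral_radial_sq (hd : d ≠ 0) (hν : IsSphereMarginal d ν) (ρ r : ℝ) :
    ∫ c, (ρ ^ 2 + r ^ 2 + 2 * ρ * r * c) ^ 2 ∂ν =
      (ρ ^ 2 + r ^ 2) ^ 2 + 4 * ρ ^ 2 * r ^ 2 / d := by
  have := hν.prob
  have e : ∀ c : ℝ, (ρ ^ 2 + r ^ 2 + 2 * ρ * r * c) ^ 2 = (ρ ^ 2 + r ^ 2) ^ 2 +
      (4 * ρ * r * (ρ ^ 2 + r ^ 2)) * c + (4 * ρ ^ 2 * r ^ 2) * c ^ 2 := fun c => by ring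
  simp only [e]
  rw [integral_add (hν.integrable (by fun_prop)) (hν.integrable (by fun_prop)),
    integral_add (integrable_const _) (hν.integrable (by fun_prop)), integral_const_mul,
    integral_const_mul, hν.integral_id, hν.integral_sq hd]
  simp
  ring

theorem convexOn_powMean_sub_quartic (hd : 2 ≤ d) (hν : IsSphereMarginal d ν) (hε : 0 < ε)
    {ρ q₂ q₃ q₄ : ℝ}
    (hl : ∀ r, d / 2 * (2 * (1 + d / 2) * q₂) +
      2 * (1 + d / 2) * (3 * (2 + d / 2) * q₃) * r ^ 2 +
      3 * (2 + d / 2) * (4 * (3 + d / 2) * q₄) * (r ^ 2) ^ 2 ≤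
      bilaplaceCoeff d β * powMean ν ε (β - 2) ρ r - β * (β - 1) * (β - 2) * ε *
        ((2 * β + d - 4) * powMean ν ε (β - 3) ρ r - (β - 3) * ε * powMean ν ε (β - 4) ρ r)) :
    ConvexOn ℝ (Set.Ici 0)
      (fun y => powMean ν ε β ρ √y - (q₂ * y ^ 2 + q₃ * y ^ 3 + q₄ * y ^ 4)) := by
  have h1 := hν.isEPD_powMean (γ := β) hd (Or.inl hε) ρ
  have h2 := hν.isEPD_powMean (γ := β - 1) hd (Or.inl hε) ρ
  have h3 := hν.isEPD_powMean (γ := β - 2) hd (Or.inl hε) ρ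
  refine h1.convexOn_sub_quartic hd ((h2.const_mul _).sub (h3.const_mul _)) fun r => ?_
  refine (hl r).trans_eq ?_
  rw [show β - 1 - 1 = β - 2 by ring, show β - 1 - 2 = β - 3 by ring,
    show β - 2 - 1 = β - 3 by ring, show β - 2 - 2 = β - 4 by ring, bilaplaceCoeff]
  ring

theorem hasQuarticMinorant_of_le_two (hd : 2 ≤ d) (hν : IsSphereMarginal d ν) (hε : 0 < ε)
    (hβ1 : 1 ≤ β) (hβ2 : β ≤ 2) :
    HasQuarticMinorant (powMean ν ε β)
      (bilaplaceCoeff d β / (d / 2 * (2 * (1 + d / 2))) * (1 + (β - 2) * (ε - 1)))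
      (bilaplaceCoeff d β / (d / 2 * (2 * (1 + d / 2))) * (β - 2)) 0
      (bilaplaceCoeff d β / (2 * (1 + d / 2) * (3 * (2 + d / 2))) * (β - 2)) 0 0 := by
  intro ρ
  have := hν.prob
  have hd' : (2 : ℝ) ≤ d := by exact_mod_cast hd
  refine hν.convexOn_powMean_sub_quartic hd hε fun r => ?_
  have hK := bilaplaceCoeff_nonneg hd hβ1
  set K := bilaplaceCoeff d β
  have hM : 1 + (β - 2) * (ρ ^ 2 + r ^ 2 + ε - 1) ≤ powMean ν ε (β - 2) ρ r := by
    rw [← hν.integral_radial ρ r]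
    calc 1 + (β - 2) * (∫ c, (ρ ^ 2 + r ^ 2 + 2 * ρ * r * c) ∂ν + ε - 1)
        = ∫ c, ((β - 2) * (ρ ^ 2 + r ^ 2 + 2 * ρ * r * c) + (1 + (β - 2) * (ε - 1))) ∂ν := by
          rw [integral_add (hν.integrable (by fun_prop)) (integrable_const _), integral_const_mul]
          simp
          ring
      _ ≤ powMean ν ε (β - 2) ρ r := by
          refine integral_mono_ae (hν.integrable (by fun_prop))
            (hν.integrable_powMean (Or.inl hε) ρ r) ?_
          filter_upwards [hν.mem_Icc] with c hc
          have := one_add_mul_sub_le_rpow_of_nonpos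
            (add_pos_of_nonneg_of_pos (sq_add_sq_add_nonneg hc ρ r) hε) (sub_nonpos.2 hβ2)
          linarith
  have h3 := hν.powMean_nonneg (γ := β - 3) hε.le ρ r
  have h4 := hν.powMean_nonneg (γ := β - 4) hε.le ρ r
  have herr : 0 ≤ β * (β - 1) * (2 - β) * ε *
      ((2 * β + d - 4) * powMean ν ε (β - 3) ρ r + (3 - β) * ε * powMean ν ε (β - 4) ρ r) := by
    have h1 : 0 ≤ β - 1 := by linarith
    have h2 : 0 ≤ 2 - β := by linarith
    have h5 : 0 ≤ 3 - β := by linarith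
    have h6 : 0 ≤ 2 * β + d - 4 := by linarith
    positivity
  have hKM := mul_le_mul_of_nonneg_left hM hK
  calc _ = K * (1 + (β - 2) * (ρ ^ 2 + r ^ 2 + ε - 1)) := by field_simp; ring
    _ ≤ _ := by linarith

theorem hasQuarticMinorant_of_two_lt (hd : 2 ≤ d) (hν : IsSphereMarginal d ν) (hε : 0 < ε)
    (hβ2 : 2 < β) (hβ3 : β ≤ 3) {t : ℝ} (ht : 0 < t) :
    HasQuarticMinorant (powMean ν ε β)
      (-(β * (β - 1) * (β - 2) * (β + d - 1) * ε ^ (β - 2) / (d / 2 * (2 * (1 + d / 2)))))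
      (bilaplaceCoeff d β / (d / 2 * (2 * (1 + d / 2))) * ((4 - β) * t ^ (β - 3)))
      (-(bilaplaceCoeff d β / (d / 2 * (2 * (1 + d / 2))) * ((3 - β) * t ^ (β - 4))))
      (bilaplaceCoeff d β / (2 * (1 + d / 2) * (3 * (2 + d / 2))) * ((4 - β) * t ^ (β - 3)))
      (-(bilaplaceCoeff d β / (2 * (1 + d / 2) * (3 * (2 + d / 2))) *
        ((3 - β) * t ^ (β - 4) * (2 + 4 / d))))
      (-(bilaplaceCoeff d β / (3 * (2 + d / 2) * (4 * (3 + d / 2))) *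
        ((3 - β) * t ^ (β - 4)))) := by
  intro ρ
  have := hν.prob
  have hd' : (2 : ℝ) ≤ d := by exact_mod_cast hd
  refine hν.convexOn_powMean_sub_quartic hd hε fun r => ?_
  have hK : 0 ≤ bilaplaceCoeff d β := bilaplaceCoeff_nonneg hd (by linarith)
  set K := bilaplaceCoeff d β
  set u := (4 - β) * t ^ (β - 3)
  set w := (3 - β) * t ^ (β - 4)
  have hM : u * (ρ ^ 2 + r ^ 2) - w * ((ρ ^ 2 + r ^ 2) ^ 2 + 4 * ρ ^ 2 * r ^ 2 / d) ≤
      powMean ν ε (β - 2) ρ r := by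
    rw [← hν.integral_radial_sq (by omega) ρ r]
    nth_rewrite 1 [← hν.integral_radial ρ r]
    rw [← integral_const_mul, ← integral_const_mul,
      ← integral_sub (hν.integrable (by fun_prop)) (hν.integrable (by fun_prop))]
    refine integral_mono_ae (hν.integrable (by fun_prop))
      (hν.integrable_powMean (Or.inl hε) ρ r) ?_
    filter_upwards [hν.mem_Icc] with c hc
    have hA := sq_add_sq_add_nonneg hc ρ r
    have h := quadratic_le_rpow (m := β - 2) (by linarith) (by linarith) ht hA
    rw [show 2 - (β - 2) = 4 - β by ring, show 1 - (β - 2) = 3 - β by ring,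
      show β - 2 - 1 = β - 3 by ring, show β - 2 - 2 = β - 4 by ring] at h
    exact h.trans (Real.rpow_le_rpow hA (by linarith) (by linarith))
  have e3 : ε * powMean ν ε (β - 3) ρ r ≤ ε ^ (β - 2) := by
    have := Real.rpow_sub_one hε.ne' (β - 2)
    rw [show β - 2 - 1 = β - 3 by ring, eq_div_iff hε.ne'] at this
    rw [← this, mul_comm]
    exact mul_le_mul_of_nonneg_right (hν.powMean_le_rpow hε (by linarith) ρ r) hε.le
  have e4 : ε * (ε * powMean ν ε (β - 4) ρ r) ≤ ε ^ (β - 2) := by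
    have := Real.rpow_sub_natCast hε.ne' (β - 2) 2
    rw [Nat.cast_ofNat, show β - 2 - 2 = β - 4 by ring, eq_div_iff (by positivity)] at this
    rw [← this, ← mul_assoc, ← sq, mul_comm]
    exact mul_le_mul_of_nonneg_right (hν.powMean_le_rpow hε (by linarith) ρ r) (by positivity)
  have hKM := mul_le_mul_of_nonneg_left hM hK
  have herr : β * (β - 1) * (β - 2) * ((2 * β + d - 4) * (ε * powMean ν ε (β - 3) ρ r) +
      (3 - β) * (ε * (ε * powMean ν ε (β - 4) ρ r))) ≤
      β * (β - 1) * (β - 2) * (β + d - 1) * ε ^ (β - 2) := by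
    have h1 : 0 ≤ β * (β - 1) * (β - 2) :=
      mul_nonneg (mul_nonneg (by linarith) (by linarith)) (by linarith)
    rw [mul_assoc _ (β + d - 1)]
    refine mul_le_mul_of_nonneg_left ?_ h1
    have i1 := mul_le_mul_of_nonneg_left e3 (show 0 ≤ 2 * β + d - 4 by linarith)
    have i2 := mul_le_mul_of_nonneg_left e4 (show 0 ≤ 3 - β by linarith)
    linarith
  calc _ = K * (u * (ρ ^ 2 + r ^ 2) - w * ((ρ ^ 2 + r ^ 2) ^ 2 + 4 * ρ ^ 2 * r ^ 2 / d)) -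
        β * (β - 1) * (β - 2) * (β + d - 1) * ε ^ (β - 2) := by field_simp; ring
    _ ≤ _ := by linarith

end IsSphereMarginal

theorem convexOn_add_rpow_sub_cubic {β x : ℝ} (hβ : 3 ≤ β) (hx : 0 ≤ x) :
    ConvexOn ℝ (Set.Ici 0) (fun y => (x + y) ^ β -
      ((β * (β - 1) * (3 - β) / 2 + β * (β - 1) * (β - 2) / 2 * x) * y ^ 2 +
        β * (β - 1) * (β - 2) / 6 * y ^ 3)) := by
  have hder : ∀ δ : ℝ, 1 ≤ δ → ∀ y : ℝ,
      HasDerivAt (fun y => (x + y) ^ δ) (δ * (x + y) ^ (δ - 1)) y := fun δ hδ y =>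
    (((hasDerivAt_id y).const_add x).rpow_const (p := δ) (Or.inr hδ)).congr_deriv (by simp)
  set u := β * (β - 1) * (3 - β) / 2 + β * (β - 1) * (β - 2) / 2 * x
  set w := β * (β - 1) * (β - 2) / 6
  refine convexOn_Ici_of_hasDerivAt2_nonneg
    (f₁ := fun y => β * (x + y) ^ (β - 1) - (u * (2 * y) + w * (3 * y ^ 2)))
    (f₂ := fun y => β * ((β - 1) * (x + y) ^ (β - 2)) - (u * 2 + w * (6 * y)))
    (fun y _ => ?_) (fun y _ => ?_) fun y hy => ?_
  · exact (hder β (by linarith) y).sub ((((hasDerivAt_pow 2 y).const_mul u).add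
      ((hasDerivAt_pow 3 y).const_mul w)).congr_deriv (by simp))
  · have h := (hder (β - 1) (by linarith) y).const_mul β
    rw [show β - 1 - 1 = β - 2 by ring] at h
    exact h.sub (((((hasDerivAt_id y).const_mul 2).const_mul u).add
      (((hasDerivAt_pow 2 y).const_mul 3).const_mul w)).congr_deriv (by push_cast; ring))
  · have h := one_add_mul_self_le_rpow_one_add (s := x + y - 1) (by linarith)
      (show 1 ≤ β - 2 by linarith)
    rw [add_sub_cancel] at h
    have hb : 0 ≤ β * (β - 1) := mul_nonneg (by linarith) (by linarith)
    have := mul_le_mul_of_nonneg_left h hb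
    simp only [u, w]
    linarith

namespace IsSphereMarginal

variable {d : ℕ} {ν : Measure ℝ} {β : ℝ}

theorem rpow_le_powMean (hν : IsSphereMarginal d ν) {γ : ℝ} (hγ : 1 ≤ γ) (ρ r : ℝ) :
    (ρ ^ 2 + r ^ 2) ^ γ ≤ powMean ν 0 γ ρ r := by
  have := hν.prob
  have h := (convexOn_rpow hγ).map_integral_le (μ := ν)
    (f := fun c => ρ ^ 2 + r ^ 2 + 2 * ρ * r * c)
    (continuousOn_id.rpow_const fun t _ => Or.inr (by linarith)) isClosed_Ici
    (by filter_upwards [hν.mem_Icc] with c hc using sq_add_sq_add_nonneg hc ρ r)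
    (hν.integrable (by fun_prop))
    (by
      have := hν.integrable_powMean (ε := 0) (γ := γ) (Or.inr ⟨le_rfl, by linarith⟩) ρ r
      simpa [Function.comp_def] using this)
  rw [hν.integral_radial] at h
  simpa [powMean, radialMean] using h

theorem convexOn_powMean_sub_add_rpow (hd : 2 ≤ d) (hν : IsSphereMarginal d ν) (hβ : 3 ≤ β)
    (ρ : ℝ) :
    ConvexOn ℝ (Set.Ici 0) (fun y => powMean ν 0 β ρ √y - (ρ ^ 2 + y) ^ β) := by
  have := hν.prob
  have hd' : (2 : ℝ) ≤ d := by exact_mod_cast hd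
  rcases eq_or_ne ρ 0 with rfl | hρ
  · refine (convexOn_const 0 (convex_Ici 0)).congr fun y hy => ?_
    simp [powMean, radialMean, Real.sq_sqrt (Set.mem_Ici.1 hy)]
  set x := ρ ^ 2 with hx
  have hx0 : 0 < x := by positivity
  have hder : ∀ δ : ℝ, ∀ t : ℝ, 0 ≤ t →
      HasDerivAt (fun t => (x + t) ^ δ) (δ * (x + t) ^ (δ - 1)) t := fun δ t ht =>
    (((hasDerivAt_id t).const_add x).rpow_const (p := δ)
      (Or.inl (by simp only [id]; positivity))).congr_deriv (by simp)
  have hder2 : ∀ δ : ℝ, ∀ t : ℝ, 0 ≤ t →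
      HasDerivAt (fun t => δ * (x + t) ^ (δ - 1)) (δ * ((δ - 1) * (x + t) ^ (δ - 2))) t :=
    fun δ t ht => by
      have := (hder (δ - 1) t ht).const_mul δ
      rwa [show δ - 1 - 1 = δ - 2 by ring] at this
  have h1 := IsEPD.comp_sq hd (hder β) (hder2 β)
  have h2 := ((IsEPD.comp_sq hd (hder (β - 1)) (hder2 (β - 1))).const_mul
    (β * (β + d / 2 - 1))).sub
    ((IsEPD.comp_sq hd (hder (β - 2)) (hder2 (β - 2))).const_mul (β * (β - 1) * x))
  have he : (fun r : ℝ => r ^ 2 * (β * ((β - 1) * (x + r ^ 2) ^ (β - 2))) +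
      d / 2 * (β * (x + r ^ 2) ^ (β - 1))) = fun r => β * (β + d / 2 - 1) *
        (x + r ^ 2) ^ (β - 1) - β * (β - 1) * x * (x + r ^ 2) ^ (β - 2) := by
    ext r
    have hs : 0 < x + r ^ 2 := by positivity
    have := Real.rpow_sub_one hs.ne' (β - 1)
    rw [show β - 1 - 1 = β - 2 by ring, eq_div_iff hs.ne'] at this
    rw [← this]
    ring
  rw [he] at h1
  have g1 := hν.isEPD_powMean (ε := 0) (γ := β) hd (Or.inr ⟨le_rfl, by linarith⟩) ρ
  have g2 := (hν.isEPD_powMean (ε := 0) (γ := β - 1) hd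
    (Or.inr ⟨le_rfl, by linarith⟩) ρ).const_mul (β * (β + d / 2 - 1))
  simp only [mul_zero, zero_mul, sub_zero] at g1 g2
  refine ((g1.sub h1).convexOn_comp_sqrt hd (g2.sub h2) fun r _ => ?_).congr fun y hy => ?_
  · have hs : 0 < x + r ^ 2 := by positivity
    have hM := hν.rpow_le_powMean (γ := β - 2) (by linarith) ρ r
    rw [← hx] at hM
    simp only [show β - 1 - 1 = β - 2 by ring, show β - 1 - 2 = β - 3 by ring,
      show β - 2 - 1 = β - 3 by ring, show β - 2 - 2 = β - 4 by ring]
    have hK := mul_le_mul_of_nonneg_left hM (bilaplaceCoeff_nonneg hd (show 1 ≤ β by linarith))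
    set M := powMean ν 0 (β - 2) ρ r
    have e3 : (x + r ^ 2) ^ (β - 3) = (x + r ^ 2) ^ (β - 4) * (x + r ^ 2) := by
      have := Real.rpow_sub_one hs.ne' (β - 3)
      rw [show β - 3 - 1 = β - 4 by ring, eq_div_iff hs.ne'] at this
      exact this.symm
    have e2 : (x + r ^ 2) ^ (β - 2) = (x + r ^ 2) ^ (β - 3) * (x + r ^ 2) := by
      have := Real.rpow_sub_one hs.ne' (β - 2)
      rw [show β - 2 - 1 = β - 3 by ring, eq_div_iff hs.ne'] at this
      exact this.symm
    have hP : 0 ≤ (x + r ^ 2) ^ (β - 4) := Real.rpow_nonneg hs.le _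
    rw [e2, e3] at hK ⊢
    set Q := (x + r ^ 2) ^ (β - 4)
    have hpos : 0 ≤ β * (β - 1) * (β - 2) * x * Q *
        ((2 * β + d - 4) * r ^ 2 + (β + d - 1) * x) := by
      have i1 : 0 ≤ β - 1 := by linarith
      have i2 : 0 ≤ β - 2 := by linarith
      have i3 : 0 ≤ 2 * β + d - 4 := by linarith
      have i4 : 0 ≤ β + d - 1 := by linarith
      positivity
    unfold bilaplaceCoeff at hK
    linarith
  · simp only [Real.sq_sqrt (Set.mem_Ici.1 hy)]

theorem hasQuarticMinorant_of_three_le (hd : 2 ≤ d) (hν : IsSphereMarginal d ν) (hβ : 3 ≤ β) :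
    HasQuarticMinorant (powMean ν 0 β) (β * (β - 1) * (3 - β) / 2) (β * (β - 1) * (β - 2) / 2) 0
      (β * (β - 1) * (β - 2) / 6) 0 0 := by
  intro ρ
  refine ((hν.convexOn_powMean_sub_add_rpow hd hβ ρ).add
    (convexOn_add_rpow_sub_cubic hβ (sq_nonneg ρ))).congr fun y _ => ?_
  simp only [Pi.add_apply]
  ring

end IsSphereMarginal

theorem ae_prod_mem_prod {X Y : Type*} [MeasurableSpace X] [MeasurableSpace Y] {μ : Measure X}
    {ν : Measure Y} [SFinite μ] [SFinite ν] {s : Set X} {t : Set Y} (hs : MeasurableSet s)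
    (ht : MeasurableSet t) (hμ : ∀ᵐ x ∂μ, x ∈ s) (hν : ∀ᵐ y ∂ν, y ∈ t) :
    ∀ᵐ z ∂(μ.prod ν), z ∈ s ×ˢ t := by
  rw [← Measure.restrict_eq_self_of_ae_mem hμ, ← Measure.restrict_eq_self_of_ae_mem hν,
    Measure.prod_restrict]
  exact ae_restrict_mem (hs.prod ht)

namespace IsSphereMarginal

variable {d : ℕ} {ν : Measure ℝ}

theorem continuous_radialMean (hν : IsSphereMarginal d ν) {f : ℝ → ℝ} (hf : Continuous f) :
    Continuous (fun q : ℝ × ℝ => radialMean ν f q.1 q.2) := by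
  have := hν.prob
  unfold radialMean
  rw [← Measure.restrict_eq_self_of_ae_mem hν.mem_Icc]
  exact continuous_parametric_integral_of_continuous
    (f := fun (q : ℝ × ℝ) c => f (q.1 ^ 2 + q.2 ^ 2 + 2 * q.1 * q.2 * c))
    (by unfold Function.uncurry; fun_prop) isCompact_Icc

theorem integral_quartic (hd : d ≠ 0) (hν : IsSphereMarginal d ν) (q₂ q₃ q₄ σ b : ℝ) :
    ∫ c, (q₂ * (σ + b * c) ^ 2 + q₃ * (σ + b * c) ^ 3 + q₄ * (σ + b * c) ^ 4) ∂ν =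
      q₂ * (σ ^ 2 + b ^ 2 / d) + q₃ * (σ ^ 3 + 3 * σ * b ^ 2 / d) +
        q₄ * (σ ^ 4 + 6 * σ ^ 2 * b ^ 2 / d + b ^ 4 * ∫ c, c ^ 4 ∂ν) := by
  have := hν.prob
  have e : ∀ c : ℝ, q₂ * (σ + b * c) ^ 2 + q₃ * (σ + b * c) ^ 3 + q₄ * (σ + b * c) ^ 4 =
      (q₂ * σ ^ 2 + q₃ * σ ^ 3 + q₄ * σ ^ 4) +
      (2 * q₂ * σ * b + 3 * q₃ * σ ^ 2 * b + 4 * q₄ * σ ^ 3 * b) * c +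
      (q₂ * b ^ 2 + 3 * q₃ * σ * b ^ 2 + 6 * q₄ * σ ^ 2 * b ^ 2) * c ^ 2 +
      (q₃ * b ^ 3 + 4 * q₄ * σ * b ^ 3) * c ^ 3 + (q₄ * b ^ 4) * c ^ 4 := fun c => by ring
  simp only [e]
  rw [integral_add (hν.integrable (by fun_prop)) (hν.integrable (by fun_prop)),
    integral_add (hν.integrable (by fun_prop)) (hν.integrable (by fun_prop)),
    integral_add (hν.integrable (by fun_prop)) (hν.integrable (by fun_prop)),
    integral_add (integrable_const _) (hν.integrable (by fun_prop)), integral_const_mul,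
    integral_const_mul, integral_const_mul, integral_const_mul, hν.integral_id, hν.integral_sq hd,
    hν.integral_pow_three]
  simp
  ring

theorem integral_radialMean_diff_ge (hd : d ≠ 0) (hν : IsSphereMarginal d ν) {f : ℝ → ℝ}
    (hf : Continuous f) {a₀ a₁ a₂ b₀ b₁ c₀ : ℝ}
    (hq : HasQuarticMinorant (radialMean ν f) a₀ a₁ a₂ b₀ b₁ c₀) (hc₀ : c₀ ≤ 0) {σ b b' : ℝ}
    (hb : |b| ≤ |b'|) (hb' : |b'| ≤ σ) (ρ : ℝ) :
    (b' ^ 2 - b ^ 2) / d * (a₀ + a₁ * ρ ^ 2 + a₂ * ρ ^ 4 + 3 * σ * (b₀ + b₁ * ρ ^ 2) +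
      8 * σ ^ 2 * c₀) ≤
    ∫ c, radialMean ν f ρ √(σ + b' * c) ∂ν - ∫ c, radialMean ν f ρ √(σ + b * c) ∂ν := by
  have hcont : ∀ u, Continuous fun y => radialMean ν f ρ √(σ + u * y) := fun u =>
    (hν.continuous_radialMean hf).comp (by fun_prop : Continuous fun y => (ρ, √(σ + u * y)))
  have hcont0 : Continuous fun y => radialMean ν f ρ √y :=
    (hν.continuous_radialMean hf).comp (by fun_prop : Continuous fun y => (ρ, √y))
  have h := hν.integral_comp_le_of_convexOn (hq ρ)
    ((hcont0.continuousOn).sub (by fun_prop)) hb hb'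
  rw [integral_sub (hν.integrable (hcont b).continuousOn) (hν.integrable (by fun_prop)),
    integral_sub (hν.integrable (hcont b').continuousOn) (hν.integrable (by fun_prop)),
    hν.integral_quartic hd, hν.integral_quartic hd] at h
  have hsq : b ^ 2 ≤ b' ^ 2 := sq_le_sq.2 hb
  have hsq' : b' ^ 2 ≤ σ ^ 2 := sq_le_sq.2 (hb'.trans (le_abs_self σ))
  have hm : (b' ^ 4 - b ^ 4) * ∫ c, c ^ 4 ∂ν ≤ (b' ^ 2 - b ^ 2) * (2 * σ ^ 2) * (1 / d) := by
    refine mul_le_mul ?_ (hν.integral_pow_four_le hd) (integral_nonneg fun c => by positivity) ?_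
    · nlinarith
    · exact mul_nonneg (by linarith) (by positivity)
  have := mul_le_mul_of_nonpos_left hm hc₀
  have hd' : (d : ℝ) ≠ 0 := by exact_mod_cast hd
  have e : (b' ^ 2 - b ^ 2) / d * (a₀ + a₁ * ρ ^ 2 + a₂ * ρ ^ 4 + 3 * σ * (b₀ + b₁ * ρ ^ 2) +
      8 * σ ^ 2 * c₀) = (a₀ + a₁ * ρ ^ 2 + a₂ * ρ ^ 4) * (b' ^ 2 / d - b ^ 2 / d) +
      (b₀ + b₁ * ρ ^ 2) * (3 * σ * b' ^ 2 / d - 3 * σ * b ^ 2 / d) +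
      c₀ * (6 * σ ^ 2 * b' ^ 2 / d - 6 * σ ^ 2 * b ^ 2 / d) +
      c₀ * ((b' ^ 2 - b ^ 2) * (2 * σ ^ 2) * (1 / d)) := by
    field_simp
    ring
  rw [e]
  linarith

end IsSphereMarginal

section RotationInvariant

variable {d : ℕ} {μ : Measure (EuclideanSpace ℝ (Fin d))} [IsProbabilityMeasure μ] {R : ℝ}

theorem integral_norm_add_sq_eq_radialMean (i : Fin d)
    (hinv : ∀ L : EuclideanSpace ℝ (Fin d) ≃ₗᵢ[ℝ] EuclideanSpace ℝ (Fin d), μ.map L = μ)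
    (hR : ∀ᵐ v ∂μ, ‖v‖ ≤ R) {f : ℝ → ℝ} (hf : Continuous f) (z : EuclideanSpace ℝ (Fin d)) :
    ∫ v, f (‖v + z‖ ^ 2) ∂μ =
      ∫ v, radialMean (sphereMarginal i) f ‖v‖ ‖z‖ ∂μ := by
  have := isProbabilityMeasure_sphereUniform i.pos
  have hrot : ∀ ζ : EuclideanSpace ℝ (Fin d), ‖z‖ = ‖ζ‖ →
      ∫ v, f (‖v + ζ‖ ^ 2) ∂μ = ∫ v, f (‖v + z‖ ^ 2) ∂μ := by
    intro ζ hζ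
    set L := (Submodule.span ℝ {z - ζ})ᗮ.reflection
    have hL : L z = ζ := Submodule.reflection_sub hζ
    have hmp : MeasurePreserving L μ μ := ⟨L.continuous.measurable, hinv L⟩
    rw [← hmp.integral_comp L.toHomeomorph.measurableEmbedding]
    refine integral_congr_ae (Filter.Eventually.of_forall fun v => ?_)
    change f (‖L v + ζ‖ ^ 2) = f (‖v + z‖ ^ 2)
    rw [← hL, ← map_add, L.norm_map]
  calc ∫ v, f (‖v + z‖ ^ 2) ∂μ
      = ∫ x, ∫ v, f (‖v + ‖z‖ • x‖ ^ 2) ∂μ ∂(sphereUniform d) := by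
        rw [integral_congr_ae (μ := sphereUniform d) (g := fun _ => ∫ v, f (‖v + z‖ ^ 2) ∂μ)]
        · simp
        · filter_upwards [norm_eq_one_ae_sphereUniform d] with x hx
          exact hrot _ (by simp [norm_smul, hx])
    _ = ∫ v, ∫ x, f (‖v + ‖z‖ • x‖ ^ 2) ∂(sphereUniform d) ∂μ := by
        refine integral_integral_swap ?_
        refine ContinuousOn.integrable_of_ae_mem_compact
          ((isCompact_sphere (0 : EuclideanSpace ℝ (Fin d)) 1).prod
            (isCompact_closedBall (0 : EuclideanSpace ℝ (Fin d)) R))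
          (ae_prod_mem_prod Metric.isClosed_sphere.measurableSet measurableSet_closedBall ?_ ?_) ?_
        · simpa using norm_eq_one_ae_sphereUniform d
        · simpa using hR
        · unfold Function.uncurry
          fun_prop
    _ = _ := by
        refine integral_congr_ae (Filter.Eventually.of_forall fun v => ?_)
        have hm : Measurable (fun x : EuclideanSpace ℝ (Fin d) => (inner ℝ v x : ℝ)) := by fun_prop
        calc ∫ x, f (‖v + ‖z‖ • x‖ ^ 2) ∂(sphereUniform d)
            = ∫ x, f (‖v‖ ^ 2 + ‖z‖ ^ 2 + 2 * ‖z‖ * inner ℝ v x) ∂(sphereUniform d) := by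
              refine integral_congr_ae ?_
              filter_upwards [norm_eq_one_ae_sphereUniform d] with x hx
              rw [norm_add_sq_real, norm_smul, inner_smul_right, hx, norm_norm]
              congr 1; ring
          _ = ∫ w, f (‖v‖ ^ 2 + ‖z‖ ^ 2 + 2 * ‖z‖ * w)
                ∂((sphereUniform d).map (fun x => inner ℝ v x)) := by
              rw [integral_map hm.aemeasurable]
              exact (by fun_prop : Continuous fun w =>
                f (‖v‖ ^ 2 + ‖z‖ ^ 2 + 2 * ‖z‖ * w)).aestronglyMeasurable
          _ = _ := by
              rw [map_inner_sphereUniform i, integral_map (by fun_prop) (by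
                exact (by fun_prop : Continuous fun w =>
                  f (‖v‖ ^ 2 + ‖z‖ ^ 2 + 2 * ‖z‖ * w)).aestronglyMeasurable)]
              unfold radialMean
              congr 1; ext c; congr 1; ring

theorem integral_comp_inner_sphereUniform (i : Fin d) {g : ℝ → ℝ} (hg : Continuous g) :
    ∫ z, g (inner ℝ z.1 z.2) ∂((sphereUniform d).prod (sphereUniform d)) =
      ∫ c, g c ∂(sphereMarginal i) := by
  have := isProbabilityMeasure_sphereUniform i.pos
  rw [integral_prod]
  · rw [integral_congr_ae (μ := sphereUniform d) (g := fun _ => ∫ c, g c ∂(sphereMarginal i))]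
    · simp
    · filter_upwards [norm_eq_one_ae_sphereUniform d] with v hv
      have hm : Measurable (fun x : EuclideanSpace ℝ (Fin d) => (inner ℝ v x : ℝ)) := by fun_prop
      rw [← integral_map hm.aemeasurable hg.aestronglyMeasurable, map_inner_sphereUniform i, hv]
      simp
  · refine ContinuousOn.integrable_of_ae_mem_compact
      ((isCompact_sphere (0 : EuclideanSpace ℝ (Fin d)) 1).prod
        (isCompact_sphere (0 : EuclideanSpace ℝ (Fin d)) 1))
      (ae_prod_mem_prod Metric.isClosed_sphere.measurableSet Metric.isClosed_sphere.measurableSet ?_ ?_) (by fun_prop)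
    · simpa using norm_eq_one_ae_sphereUniform d
    · simpa using norm_eq_one_ae_sphereUniform d

theorem integral_norm_add_pair_sq (i : Fin d)
    (hinv : ∀ L : EuclideanSpace ℝ (Fin d) ≃ₗᵢ[ℝ] EuclideanSpace ℝ (Fin d), μ.map L = μ)
    (hR : ∀ᵐ v ∂μ, ‖v‖ ≤ R) {f : ℝ → ℝ} (hf : Continuous f) (s t : ℝ) :
    ∫ q, f (‖q.1 + (s • q.2.1 + t • q.2.2)‖ ^ 2)
        ∂(μ.prod ((sphereUniform d).prod (sphereUniform d))) =
      ∫ v, ∫ c, radialMean (sphereMarginal i) f ‖v‖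
        √(s ^ 2 + t ^ 2 + 2 * s * t * c) ∂(sphereMarginal i) ∂μ := by
  have := isProbabilityMeasure_sphereUniform i.pos
  have hν := isSphereMarginal_sphereMarginal i
  have := hν.prob
  set ν := sphereMarginal i
  have hV : ∀ᵐ v ∂μ, v ∈ Metric.closedBall (0 : EuclideanSpace ℝ (Fin d)) R := by simpa using hR
  have hS : ∀ᵐ x ∂(sphereUniform d), x ∈ Metric.sphere (0 : EuclideanSpace ℝ (Fin d)) 1 := by
    simpa using norm_eq_one_ae_sphereUniform d
  have hSS := ae_prod_mem_prod Metric.isClosed_sphere.measurableSet Metric.isClosed_sphere.measurableSet hS hS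
  have hcont := hν.continuous_radialMean hf
  have hint1 : Integrable (fun q : EuclideanSpace ℝ (Fin d) ×
      (EuclideanSpace ℝ (Fin d) × EuclideanSpace ℝ (Fin d)) =>
        f (‖q.1 + (s • q.2.1 + t • q.2.2)‖ ^ 2))
      (μ.prod ((sphereUniform d).prod (sphereUniform d))) :=
    ContinuousOn.integrable_of_ae_mem_compact
      ((isCompact_closedBall _ _).prod ((isCompact_sphere _ _).prod (isCompact_sphere _ _)))
      (ae_prod_mem_prod measurableSet_closedBall
        (Metric.isClosed_sphere.measurableSet.prod Metric.isClosed_sphere.measurableSet) hV hSS)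
      (by fun_prop)
  have hcont2 : Continuous (fun q : (EuclideanSpace ℝ (Fin d) × EuclideanSpace ℝ (Fin d)) ×
      EuclideanSpace ℝ (Fin d) =>
        radialMean ν f ‖q.2‖ √(s ^ 2 + t ^ 2 + 2 * s * t * inner ℝ q.1.1 q.1.2)) :=
    hcont.comp (by fun_prop : Continuous fun q : (EuclideanSpace ℝ (Fin d) ×
      EuclideanSpace ℝ (Fin d)) × EuclideanSpace ℝ (Fin d) =>
        (‖q.2‖, √(s ^ 2 + t ^ 2 + 2 * s * t * inner ℝ q.1.1 q.1.2)))
  have hint2 : Integrable (fun q : (EuclideanSpace ℝ (Fin d) × EuclideanSpace ℝ (Fin d)) ×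
      EuclideanSpace ℝ (Fin d) =>
        radialMean ν f ‖q.2‖ √(s ^ 2 + t ^ 2 + 2 * s * t * inner ℝ q.1.1 q.1.2))
      (((sphereUniform d).prod (sphereUniform d)).prod μ) :=
    hcont2.continuousOn.integrable_of_ae_mem_compact
      (((isCompact_sphere _ _).prod (isCompact_sphere _ _)).prod (isCompact_closedBall _ _))
      (ae_prod_mem_prod
        (Metric.isClosed_sphere.measurableSet.prod Metric.isClosed_sphere.measurableSet)
        measurableSet_closedBall hSS hV)
  have hnorm : ∀ᵐ z ∂((sphereUniform d).prod (sphereUniform d)),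
      ∫ v, f (‖v + (s • z.1 + t • z.2)‖ ^ 2) ∂μ =
        ∫ v, radialMean ν f ‖v‖ √(s ^ 2 + t ^ 2 + 2 * s * t * inner ℝ z.1 z.2) ∂μ := by
    filter_upwards [hSS] with z hz
    have h1 := mem_sphere_zero_iff_norm.1 hz.1
    have h2 := mem_sphere_zero_iff_norm.1 hz.2
    have e : √(s ^ 2 + t ^ 2 + 2 * s * t * inner ℝ z.1 z.2) = ‖s • z.1 + t • z.2‖ := by
      rw [← Real.sqrt_sq (norm_nonneg (s • z.1 + t • z.2)), norm_add_sq_real, norm_smul,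
        norm_smul, inner_smul_left, inner_smul_right, h1, h2]
      congr 1
      simp
      ring
    rw [integral_norm_add_sq_eq_radialMean i hinv hR hf, e]
  rw [integral_prod_symm _ hint1, integral_congr_ae hnorm, integral_integral_swap hint2]
  congr 1
  ext v
  have hcont3 : Continuous fun c : ℝ =>
      radialMean ν f ‖v‖ √(s ^ 2 + t ^ 2 + 2 * s * t * c) :=
    hcont.comp (by fun_prop : Continuous fun c : ℝ => (‖v‖, √(s ^ 2 + t ^ 2 + 2 * s * t * c)))
  exact integral_comp_inner_sphereUniform i hcont3

theorem integral_norm_add_pair_sq_diff_ge (i : Fin d)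
    (hinv : ∀ L : EuclideanSpace ℝ (Fin d) ≃ₗᵢ[ℝ] EuclideanSpace ℝ (Fin d), μ.map L = μ)
    (hR : ∀ᵐ v ∂μ, ‖v‖ ≤ R) {f : ℝ → ℝ} (hf : Continuous f) {a₀ a₁ a₂ b₀ b₁ c₀ : ℝ}
    (hq : HasQuarticMinorant (radialMean (sphereMarginal i) f)
      a₀ a₁ a₂ b₀ b₁ c₀) (hc₀ : c₀ ≤ 0) {s t s' t' σ : ℝ} (hs : s ^ 2 + t ^ 2 = σ)
    (hs' : s' ^ 2 + t' ^ 2 = σ) (hst : |s * t| ≤ |s' * t'|) :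
    4 * ((s' * t') ^ 2 - (s * t) ^ 2) / d * (a₀ + a₁ * ∫ v, ‖v‖ ^ 2 ∂μ + a₂ * ∫ v, ‖v‖ ^ 4 ∂μ +
      3 * σ * (b₀ + b₁ * ∫ v, ‖v‖ ^ 2 ∂μ) + 8 * σ ^ 2 * c₀) ≤
    ∫ q, f (‖q.1 + (s' • q.2.1 + t' • q.2.2)‖ ^ 2)
        ∂(μ.prod ((sphereUniform d).prod (sphereUniform d))) -
      ∫ q, f (‖q.1 + (s • q.2.1 + t • q.2.2)‖ ^ 2)
        ∂(μ.prod ((sphereUniform d).prod (sphereUniform d))) := by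
  have hν := isSphereMarginal_sphereMarginal i
  have := hν.prob
  rw [integral_norm_add_pair_sq i hinv hR hf, integral_norm_add_pair_sq i hinv hR hf, hs, hs']
  set ν := sphereMarginal i
  have hV : ∀ᵐ v ∂μ, v ∈ Metric.closedBall (0 : EuclideanSpace ℝ (Fin d)) R := by simpa using hR
  have hint : ∀ g : EuclideanSpace ℝ (Fin d) → ℝ, Continuous g → Integrable g μ := fun g hg =>
    hg.continuousOn.integrable_of_ae_mem_compact (isCompact_closedBall _ _) hV
  have hcont : ∀ b, Continuous fun v : EuclideanSpace ℝ (Fin d) =>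
      ∫ c, radialMean ν f ‖v‖ √(σ + b * c) ∂ν := by
    intro b
    rw [← Measure.restrict_eq_self_of_ae_mem hν.mem_Icc]
    refine continuous_parametric_integral_of_continuous
      (f := fun (v : EuclideanSpace ℝ (Fin d)) c => radialMean (ν.restrict (Set.Icc (-1) 1)) f ‖v‖
        √(σ + b * c)) ?_ isCompact_Icc
    rw [Measure.restrict_eq_self_of_ae_mem hν.mem_Icc]
    exact (hν.continuous_radialMean hf).comp
      (by fun_prop : Continuous fun q : EuclideanSpace ℝ (Fin d) × ℝ => (‖q.1‖, √(σ + b * q.2)))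
  have h2 := hint _ (by fun_prop : Continuous fun v : EuclideanSpace ℝ (Fin d) => ‖v‖ ^ 2)
  have h4 := hint _ (by fun_prop : Continuous fun v : EuclideanSpace ℝ (Fin d) => ‖v‖ ^ 4)
  rw [← integral_sub (hint _ (hcont _)) (hint _ (hcont _))]
  have hb : |2 * s * t| ≤ |2 * s' * t'| := by
    rw [mul_assoc, mul_assoc, abs_mul, abs_mul 2]
    gcongr
  have hb' : |2 * s' * t'| ≤ σ := by
    rw [abs_le]
    constructor <;> nlinarith [sq_nonneg (s' + t'), sq_nonneg (s' - t')]
  set k := ((2 * s' * t') ^ 2 - (2 * s * t) ^ 2) / (d : ℝ)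
  calc _ = ∫ v, (k * (a₀ + 3 * σ * b₀ + 8 * σ ^ 2 * c₀) + k * (a₁ + 3 * σ * b₁) * ‖v‖ ^ 2 +
        k * a₂ * ‖v‖ ^ 4) ∂μ := by
        rw [integral_add (hint _ (by fun_prop)) (h4.const_mul _),
          integral_add (integrable_const _) (h2.const_mul _), integral_const_mul,
          integral_const_mul, integral_const_mul]
        simp [k]
        ring
    _ ≤ _ := by
        refine integral_mono (((integrable_const _).add (h2.const_mul _)).add (h4.const_mul _))
          ((hint _ (hcont _)).sub (hint _ (hcont _))) fun v => ?_
        refine le_trans (le_of_eq ?_)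
          (hν.integral_radialMean_diff_ge (by have := i.pos; omega) hf hq hc₀ hb hb' ‖v‖)
        simp only [k]
        ring

end RotationInvariant

theorem second_moment_le_two_mul_sq {a x σ m₄ : ℝ} (ha : 1 ≤ a) (hx : 0 ≤ x) (hσ : 0 ≤ σ)
    (hm₄ : m₄ ≤ (1 + 1 / a) * x ^ 2) :
    m₄ + 2 * σ * (a + 1) / (a + 2) * x + 4 / 3 * σ ^ 2 * (a * (1 + a)) / ((2 + a) * (3 + a)) ≤
      2 * (x + σ * a / (a + 2)) ^ 2 := by
  have key : 2 * (x + σ * a / (a + 2)) ^ 2 - ((1 + 1 / a) * x ^ 2 +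
      2 * σ * (a + 1) / (a + 2) * x + 4 / 3 * σ ^ 2 * (a * (1 + a)) / ((2 + a) * (3 + a))) =
      x ^ 2 * ((a - 1) / a) + 2 * x * σ * ((a - 1) / (a + 2)) +
        σ ^ 2 * (2 * a * (a - 1) * (a + 4) / (3 * (a + 2) ^ 2 * (a + 3))) := by
    field_simp
    ring
  have h1 : 0 ≤ a - 1 := by linarith
  have : 0 ≤ x ^ 2 * ((a - 1) / a) + 2 * x * σ * ((a - 1) / (a + 2)) +
        σ ^ 2 * (2 * a * (a - 1) * (a + 4) / (3 * (a + 2) ^ 2 * (a + 3))) := by positivity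
  linarith

theorem le_mul_rpow_of_le {a e m : ℝ} (ha : 1 ≤ a) (hm0 : 0 ≤ m) (hm1 : m ≤ 1)
    (he : a / (a + 2) ≤ e) :
    0.77 * (a * (a + 1)) ≤ (m + a + 1) * (m + a) * e ^ m := by
  have h1 : (a / (a + 2)) ^ m ≤ e ^ m := Real.rpow_le_rpow (by positivity) he hm0
  have h2 : a / (a + 2 * m) ≤ (a / (a + 2)) ^ m := by
    have hb := rpow_one_add_le_one_add_mul_self (s := 2 / a)
      (by linarith [show 0 ≤ 2 / a by positivity]) hm0 hm1
    have e1 : a / (a + 2) = (1 + 2 / a)⁻¹ := by field_simp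
    have e2 : a / (a + 2 * m) = (1 + m * (2 / a))⁻¹ := by field_simp
    rw [e1, e2, Real.inv_rpow (by positivity)]
    exact inv_anti₀ (by positivity) hb
  have h3 : 0.77 * (a * (a + 1)) ≤ (m + a + 1) * (m + a) * (a / (a + 2 * m)) := by
    rw [mul_div_assoc', le_div_iff₀ (by positivity)]
    have : 0.77 * (a + 1) * (a + 2 * m) ≤ (m + a + 1) * (m + a) := by nlinarith
    nlinarith
  exact h3.trans (mul_le_mul_of_nonneg_left (h2.trans h1) (by positivity))

section PairDeficit

variable {d : ℕ} {μ : Measure (EuclideanSpace ℝ (Fin d))} [IsProbabilityMeasure μ] {R : ℝ}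

/-- The `p`-th moment of `V + s ξ + t ξ'`, regularised by `ε`. -/
noncomputable def pairMoment (μ : Measure (EuclideanSpace ℝ (Fin d))) (β s t ε : ℝ) : ℝ :=
  ∫ q, (‖q.1 + (s • q.2.1 + t • q.2.2)‖ ^ 2 + ε) ^ β
    ∂(μ.prod ((sphereUniform d).prod (sphereUniform d)))

theorem continuous_pairMoment (hd : 0 < d) (hR : ∀ᵐ v ∂μ, ‖v‖ ≤ R) {β : ℝ} (hβ : 0 ≤ β)
    (s t : ℝ) : Continuous (pairMoment μ β s t) := by
  have := isProbabilityMeasure_sphereUniform hd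
  have hV : ∀ᵐ v ∂μ, v ∈ Metric.closedBall (0 : EuclideanSpace ℝ (Fin d)) R := by simpa using hR
  have hS : ∀ᵐ x ∂(sphereUniform d), x ∈ Metric.sphere (0 : EuclideanSpace ℝ (Fin d)) 1 := by
    simpa using norm_eq_one_ae_sphereUniform d
  have hSS := ae_prod_mem_prod Metric.isClosed_sphere.measurableSet
    Metric.isClosed_sphere.measurableSet hS hS
  have hVSS := ae_prod_mem_prod measurableSet_closedBall
    (Metric.isClosed_sphere.measurableSet.prod Metric.isClosed_sphere.measurableSet) hV hSS
  unfold pairMoment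
  rw [← Measure.restrict_eq_self_of_ae_mem hVSS]
  refine continuous_parametric_integral_of_continuous (f := fun ε (q : EuclideanSpace ℝ (Fin d) ×
      EuclideanSpace ℝ (Fin d) × EuclideanSpace ℝ (Fin d)) =>
      (‖q.1 + (s • q.2.1 + t • q.2.2)‖ ^ 2 + ε) ^ β) ?_
    ((isCompact_closedBall _ _).prod ((isCompact_sphere _ _).prod (isCompact_sphere _ _)))
  unfold Function.uncurry
  exact Continuous.rpow_const (by fun_prop) fun _ => Or.inr hβ

theorem pairMoment_diff_ge (hd : 2 ≤ d)
    (hinv : ∀ L : EuclideanSpace ℝ (Fin d) ≃ₗᵢ[ℝ] EuclideanSpace ℝ (Fin d), μ.map L = μ)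
    (hR : ∀ᵐ v ∂μ, ‖v‖ ≤ R) {p : ℝ} (hp : 2 ≤ p) {s t s' t' σ : ℝ}
    (hs : s ^ 2 + t ^ 2 = σ) (hs' : s' ^ 2 + t' ^ 2 = σ) (hst : |s * t| ≤ |s' * t'|)
    (hσ : σ ≤ 1) (h2 : ∫ v, ‖v‖ ^ 2 ∂μ = 1 - σ)
    (h4 : ∫ v, ‖v‖ ^ 4 ∂μ ≤ (1 + 2 / d) * (1 - σ) ^ 2) :
    2 * deficitConst p d * ((s' * t') ^ 2 - (s * t) ^ 2) ≤
      pairMoment μ (p / 2) s' t' 0 - pairMoment μ (p / 2) s t 0 := by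
  have hd0 : 0 < d := by omega
  have hd' : (2 : ℝ) ≤ d := by exact_mod_cast hd
  set i : Fin d := ⟨0, hd0⟩
  have hν := isSphereMarginal_sphereMarginal i
  have hσ0 : 0 ≤ σ := hs ▸ by positivity
  have hδ : 0 ≤ (s' * t') ^ 2 - (s * t) ^ 2 := sub_nonneg.2 (sq_le_sq.2 hst)
  set δ := (s' * t') ^ 2 - (s * t) ^ 2
  set β := p / 2 with hβ
  have hpβ : p = 2 * β := by rw [hβ]; ring
  have hβ1 : 1 ≤ β := by linarith
  have hbb : 0 ≤ β * (β - 1) := mul_nonneg (by linarith) (by linarith)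
  have hdiff : ∀ ε a₀ a₁ a₂ b₀ b₁ c₀ : ℝ,
      HasQuarticMinorant (powMean (sphereMarginal i) ε β) a₀ a₁ a₂ b₀ b₁ c₀ → c₀ ≤ 0 →
      4 * δ / d * (a₀ + a₁ * (1 - σ) + a₂ * ∫ v, ‖v‖ ^ 4 ∂μ + 3 * σ * (b₀ + b₁ * (1 - σ)) +
        8 * σ ^ 2 * c₀) ≤ pairMoment μ β s' t' ε - pairMoment μ β s t ε := by
    intro ε a₀ a₁ a₂ b₀ b₁ c₀ hq hc₀
    have := integral_norm_add_pair_sq_diff_ge i hinv hR (f := fun t => (t + ε) ^ β)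
      (Continuous.rpow_const (by fun_prop) fun _ => Or.inr (by linarith)) hq hc₀ hs hs' hst
    rw [h2] at this
    exact this
  have hlim : ∀ g : ℝ → ℝ, Continuous g → 2 * deficitConst p d * δ ≤ 4 * δ / d * g 0 →
      (∀ ε, 0 < ε → 4 * δ / d * g ε ≤ pairMoment μ β s' t' ε - pairMoment μ β s t ε) →
      2 * deficitConst p d * δ ≤ pairMoment μ β s' t' 0 - pairMoment μ β s t 0 := by
    intro g hg h0 h
    refine h0.trans ?_
    have hc : ∀ s t, Continuous (pairMoment μ β s t) := fun s t =>
      continuous_pairMoment hd0 hR (by linarith) s t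
    have t1 : Filter.Tendsto (fun ε => 4 * δ / d * g ε) (nhdsWithin 0 (Set.Ioi 0))
        (nhds (4 * δ / d * g 0)) := ((hg.const_mul _).tendsto 0).mono_left nhdsWithin_le_nhds
    have t2 := (((hc s' t').sub (hc s t)).tendsto 0).mono_left
      (nhdsWithin_le_nhds (s := Set.Ioi 0))
    exact le_of_tendsto_of_tendsto t1 t2 (by
      filter_upwards [self_mem_nhdsWithin] with ε hε using h ε hε)
  rcases le_or_gt β 2 with hβ2 | hβ2
  · have hK := bilaplaceCoeff_nonneg hd hβ1
    set U := bilaplaceCoeff d β / (d / 2 * (2 * (1 + d / 2))) with hU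
    have hU0 : 0 ≤ U := by positivity
    refine hlim (fun ε => U * (1 + (β - 2) * ε)) (by fun_prop) (le_of_eq ?_) fun ε hε => ?_
    · rw [deficitConst, if_pos (by linarith), hU, bilaplaceCoeff, hpβ]
      field_simp
      ring
    · refine le_trans (mul_le_mul_of_nonneg_left ?_ (by positivity))
        (hdiff ε _ _ _ _ _ _ (hν.hasQuarticMinorant_of_le_two hd hε hβ1 hβ2) le_rfl)
      have e : bilaplaceCoeff d β / (2 * (1 + d / 2) * (3 * (2 + d / 2))) =
          U * (d / (6 * (2 + d / 2))) := by
        rw [hU]; field_simp; ring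
      rw [e, ← hU]
      have hx : 1 - 3 * (d / (6 * (2 + d / 2))) = (2 : ℝ) / (2 + d / 2) := by field_simp; ring
      have hpos : 0 ≤ U * (2 - β) * σ * (1 - 3 * (d / (6 * (2 + d / 2)))) := by
        rw [hx]
        have : 0 ≤ 2 - β := by linarith
        positivity
      linarith
  · have hdef : 2 * deficitConst p d * δ = 4 * δ / d * (0.385 * (β * (β - 1)) / 2) := by
      rw [deficitConst, if_neg (by linarith), hpβ]
      field_simp
      ring
    rcases le_or_gt β 3 with hβ3 | hβ3
    · have hK := bilaplaceCoeff_nonneg hd hβ1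
      set U := bilaplaceCoeff d β / (d / 2 * (2 * (1 + d / 2))) with hU
      have hU0 : 0 ≤ U := by positivity
      set e := (1 - σ) + σ * (d / 2) / (d / 2 + 2) with he
      have hee : (d : ℝ) / 2 / (d / 2 + 2) ≤ e := by
        have : e - d / 2 / (d / 2 + 2) = (1 - σ) * (2 / (d / 2 + 2)) := by
          rw [he]; field_simp; ring
        have h' : 0 ≤ (1 - σ) * (2 / ((d : ℝ) / 2 + 2)) :=
          mul_nonneg (by linarith) (by positivity)
        linarith
      have he0 : 0 < e := lt_of_lt_of_le (by positivity) hee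
      have hsec := second_moment_le_two_mul_sq (a := d / 2) (x := 1 - σ) (σ := σ)
        (m₄ := ∫ v, ‖v‖ ^ 4 ∂μ) (by linarith) (by linarith) hσ0 (by
          convert h4 using 3; field_simp)
      rw [← he] at hsec
      set m₄ := ∫ v, ‖v‖ ^ 4 ∂μ
      have hpow := le_mul_rpow_of_le (a := d / 2) (e := e) (m := β - 2) (by linarith)
        (by linarith) (by linarith) hee
      set c := β * (β - 1) * (β - 2) * (β + d - 1) / (d / 2 * (2 * (1 + d / 2))) with hc
      have ht3 : (2 * e) ^ (β - 3) * (2 * e) = (2 * e) ^ (β - 2) := by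
        have := Real.rpow_sub_one (by positivity : 2 * e ≠ 0) (β - 2)
        rw [show β - 2 - 1 = β - 3 by ring, eq_div_iff (by positivity)] at this
        exact this
      have ht4 : (2 * e) ^ (β - 4) * (2 * e) ^ 2 = (2 * e) ^ (β - 2) := by
        have := Real.rpow_sub_natCast (by positivity : 2 * e ≠ 0) (β - 2) 2
        rw [Nat.cast_ofNat, show β - 2 - 2 = β - 4 by ring, eq_div_iff (by positivity)] at this
        exact this
      have hmain : 0.385 * (β * (β - 1)) / 2 ≤ U * ((2 * e) ^ (β - 2) / 2) := by
        have h1 : e ^ (β - 2) ≤ (2 * e) ^ (β - 2) :=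
          Real.rpow_le_rpow he0.le (by linarith) (by linarith)
        have h2 : 0.385 * (β * (β - 1)) / 2 ≤ U * (e ^ (β - 2) / 2) := by
          have e1 : U * (e ^ (β - 2) / 2) = β * (β - 1) *
              ((β - 2 + d / 2 + 1) * (β - 2 + d / 2) * e ^ (β - 2)) /
              (4 * (d / 2 * (d / 2 + 1))) := by
            rw [hU, bilaplaceCoeff]
            field_simp
            ring
          rw [e1, le_div_iff₀ (by positivity)]
          have := mul_le_mul_of_nonneg_left hpow hbb
          linarith
        exact h2.trans (mul_le_mul_of_nonneg_left (by linarith) hU0)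
      refine hlim (fun ε => U * ((2 * e) ^ (β - 2) / 2) - c * ε ^ (β - 2)) ?_ ?_ fun ε hε => ?_
      · exact continuous_const.sub (continuous_const.mul
          (continuous_id.rpow_const fun _ => Or.inr (by linarith)))
      · rw [hdef, Real.zero_rpow (by linarith), mul_zero, sub_zero]
        exact mul_le_mul_of_nonneg_left hmain (by positivity)
      · have hw : 0 ≤ (3 - β) * (2 * e) ^ (β - 4) :=
          mul_nonneg (by linarith) (Real.rpow_nonneg (by positivity) _)
        refine le_trans (mul_le_mul_of_nonneg_left ?_ (by positivity))
          (hdiff ε _ _ _ _ _ _ (hν.hasQuarticMinorant_of_two_lt hd hε hβ2 hβ3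
            (t := 2 * e) (by positivity)) (by
              rw [neg_nonpos]
              positivity))
        set w := (3 - β) * (2 * e) ^ (β - 4) with hwdef
        set u := (4 - β) * (2 * e) ^ (β - 3) with hudef
        have hue : u * e - w * (2 * e ^ 2) = (2 * e) ^ (β - 2) / 2 := by
          have : w * (2 * e ^ 2) = (3 - β) * (2 * e) ^ (β - 2) / 2 := by
            rw [hwdef, ← ht4]; ring
          rw [this, hudef]
          have : (4 - β) * (2 * e) ^ (β - 3) * e = (4 - β) * (2 * e) ^ (β - 2) / 2 := by
            rw [← ht3]; ring
          rw [this]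
          ring
        have hUw := mul_le_mul_of_nonneg_left (mul_le_mul_of_nonneg_left hsec hw) hU0
        rw [← hue]
        refine le_trans (b := U * (u * e) - U * (w * (m₄ + 2 * σ * (d / 2 + 1) / (d / 2 + 2) *
          (1 - σ) + 4 / 3 * σ ^ 2 * (d / 2 * (1 + d / 2)) / ((2 + d / 2) * (3 + d / 2)))) -
          c * ε ^ (β - 2)) (by linarith) (le_of_eq ?_)
        have eB : bilaplaceCoeff d β / (2 * (1 + d / 2) * (3 * (2 + d / 2))) =
            U * (d / (6 * (2 + d / 2))) := by
          rw [hU]; field_simp; ring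
        have eC : bilaplaceCoeff d β / (3 * (2 + d / 2) * (4 * (3 + d / 2))) =
            U * (d / 2 * (1 + d / 2) / (6 * ((2 + d / 2) * (3 + d / 2)))) := by
          rw [hU]; field_simp; ring
        rw [eB, eC, ← hU, he, hc]
        clear_value U m₄ u w
        field_simp
        ring
    · rw [hdef]
      refine le_trans (mul_le_mul_of_nonneg_left ?_ (by positivity))
        (hdiff 0 _ _ _ _ _ _ (hν.hasQuarticMinorant_of_three_le hd hβ3.le) le_rfl)
      linarith

end PairDeficit

section MomentStep

variable {d : ℕ} {μ : Measure (EuclideanSpace ℝ (Fin d))} [IsProbabilityMeasure μ] {R : ℝ}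

theorem integral_inner_sphereUniform_pow (i : Fin d) (v : EuclideanSpace ℝ (Fin d)) (k : ℕ) :
    ∫ x, (inner ℝ v x : ℝ) ^ k ∂(sphereUniform d) = ‖v‖ ^ k * ∫ c, c ^ k ∂(sphereMarginal i) := by
  have hm : Measurable (fun x : EuclideanSpace ℝ (Fin d) => (inner ℝ v x : ℝ)) := by fun_prop
  rw [← integral_map (f := fun c : ℝ => c ^ k) hm.aemeasurable (by fun_prop),
    map_inner_sphereUniform i, integral_map (by fun_prop) (by fun_prop), ← integral_const_mul]
  simp only [mul_pow]

theorem integral_norm_add_smul_sphereUniform (i : Fin d) (v : EuclideanSpace ℝ (Fin d)) (a : ℝ) :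
    ∫ x, ‖v + a • x‖ ^ 2 ∂(sphereUniform d) = ‖v‖ ^ 2 + a ^ 2 ∧
      ∫ x, ‖v + a • x‖ ^ 4 ∂(sphereUniform d) =
        ‖v‖ ^ 4 + (2 + 4 / d) * a ^ 2 * ‖v‖ ^ 2 + a ^ 4 := by
  have := isProbabilityMeasure_sphereUniform i.pos
  have hν := isSphereMarginal_sphereMarginal i
  have hS : ∀ᵐ x ∂(sphereUniform d), x ∈ Metric.sphere (0 : EuclideanSpace ℝ (Fin d)) 1 := by
    simpa using norm_eq_one_ae_sphereUniform d
  have hint : ∀ g : EuclideanSpace ℝ (Fin d) → ℝ, Continuous g → Integrable g (sphereUniform d) :=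
    fun g hg => hg.continuousOn.integrable_of_ae_mem_compact (isCompact_sphere _ _) hS
  have e : ∀ x ∈ Metric.sphere (0 : EuclideanSpace ℝ (Fin d)) 1,
      ‖v + a • x‖ ^ 2 = (‖v‖ ^ 2 + a ^ 2) + 2 * a * (inner ℝ v x) ^ 1 := by
    intro x hx
    rw [norm_add_sq_real, norm_smul, inner_smul_right, mem_sphere_zero_iff_norm.1 hx, mul_one,
      Real.norm_eq_abs, sq_abs]
    ring
  have i1 := integral_inner_sphereUniform_pow i v 1
  have i2 := integral_inner_sphereUniform_pow i v 2
  have h1 : ∫ c, c ^ 1 ∂(sphereMarginal i) = 0 := by simpa using hν.integral_id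
  rw [h1, mul_zero] at i1
  rw [hν.integral_sq i.pos.ne'] at i2
  constructor
  · rw [integral_congr_ae (hS.mono e), integral_add (integrable_const _) (hint _ (by fun_prop)),
      integral_const_mul, i1]
    simp
  · have e' : ∀ x ∈ Metric.sphere (0 : EuclideanSpace ℝ (Fin d)) 1, ‖v + a • x‖ ^ 4 =
        (‖v‖ ^ 2 + a ^ 2) ^ 2 + 4 * a * (‖v‖ ^ 2 + a ^ 2) * (inner ℝ v x) ^ 1 +
          4 * a ^ 2 * (inner ℝ v x) ^ 2 := by
      intro x hx
      rw [show ‖v + a • x‖ ^ 4 = (‖v + a • x‖ ^ 2) ^ 2 by ring, e x hx]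
      ring
    rw [integral_congr_ae (hS.mono e'),
      integral_add (hint _ (by fun_prop)) (hint _ (by fun_prop)),
      integral_add (integrable_const _) (hint _ (by fun_prop)), integral_const_mul,
      integral_const_mul, i1, i2]
    simp
    ring

theorem integral_norm_add_smul_prod (i : Fin d) (hR : ∀ᵐ v ∂μ, ‖v‖ ≤ R) (a : ℝ) :
    ∫ q, ‖q.1 + a • q.2‖ ^ 2 ∂(μ.prod (sphereUniform d)) = ∫ v, ‖v‖ ^ 2 ∂μ + a ^ 2 ∧
      ∫ q, ‖q.1 + a • q.2‖ ^ 4 ∂(μ.prod (sphereUniform d)) =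
        ∫ v, ‖v‖ ^ 4 ∂μ + (2 + 4 / d) * a ^ 2 * ∫ v, ‖v‖ ^ 2 ∂μ + a ^ 4 := by
  have := isProbabilityMeasure_sphereUniform i.pos
  have hV : ∀ᵐ v ∂μ, v ∈ Metric.closedBall (0 : EuclideanSpace ℝ (Fin d)) R := by simpa using hR
  have hS : ∀ᵐ x ∂(sphereUniform d), x ∈ Metric.sphere (0 : EuclideanSpace ℝ (Fin d)) 1 := by
    simpa using norm_eq_one_ae_sphereUniform d
  have hint : ∀ g : EuclideanSpace ℝ (Fin d) → ℝ, Continuous g → Integrable g μ :=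
    fun g hg => hg.continuousOn.integrable_of_ae_mem_compact (isCompact_closedBall _ _) hV
  have hint2 : ∀ g : EuclideanSpace ℝ (Fin d) × EuclideanSpace ℝ (Fin d) → ℝ, Continuous g →
      Integrable g (μ.prod (sphereUniform d)) := fun g hg =>
    hg.continuousOn.integrable_of_ae_mem_compact
      ((isCompact_closedBall _ _).prod (isCompact_sphere _ _))
      (ae_prod_mem_prod measurableSet_closedBall Metric.isClosed_sphere.measurableSet hV hS)
  have hstep := fun v => integral_norm_add_smul_sphereUniform i v a
  constructor
  · rw [integral_prod _ (hint2 _ (by fun_prop))]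
    simp only [(hstep _).1]
    rw [integral_add (hint _ (by fun_prop)) (integrable_const _)]
    simp
  · rw [integral_prod _ (hint2 _ (by fun_prop))]
    simp only [(hstep _).2]
    rw [integral_add (hint _ (by fun_prop)) (integrable_const _),
      integral_add (hint _ (by fun_prop)) (hint _ (by fun_prop)), integral_const_mul]
    simp

end MomentStep

section RandomSums

variable {d : ℕ} {Ω : Type*} [MeasurableSpace Ω] {P : Measure Ω} {ι : Type*}
  {ξ : ι → Ω → EuclideanSpace ℝ (Fin d)}

theorem aemeasurable_sum_smul (hξ : ∀ j, HasLaw (ξ j) (sphereUniform d) P) (a : ι → ℝ)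
    (S : Finset ι) : AEMeasurable (fun ω => ∑ k ∈ S, a k • ξ k ω) P :=
  Finset.aemeasurable_fun_sum S fun k _ => (hξ k).aemeasurable.const_smul (a k)

theorem indepFun_sum_smul_of_disjoint (hξ : ∀ j, HasLaw (ξ j) (sphereUniform d) P)
    (hi : iIndepFun ξ P) (a : ι → ℝ) {S T : Finset ι} (hST : Disjoint S T) :
    IndepFun (fun ω => ∑ k ∈ S, a k • ξ k ω) (fun ω (k : T) => ξ k ω) P := by
  have h := (hi.indepFun_finset₀ S T hST fun j => (hξ j).aemeasurable).comp
    (φ := fun x : S → EuclideanSpace ℝ (Fin d) => ∑ k : S, a k • x k) (ψ := id)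
    (by fun_prop) measurable_id
  have e : ((fun x : S → EuclideanSpace ℝ (Fin d) => ∑ k : S, a k • x k) ∘
      fun ω (k : S) => ξ k ω) = fun ω => ∑ k ∈ S, a k • ξ k ω := by
    ext1 ω
    exact Finset.sum_coe_sort S fun k => a k • ξ k ω
  rw [e] at h
  exact h

variable [Fintype ι]

theorem norm_sum_smul_le_ae (hξ : ∀ j, HasLaw (ξ j) (sphereUniform d) P) (a : ι → ℝ)
    (S : Finset ι) :
    ∀ᵐ v ∂(P.map (fun ω => ∑ k ∈ S, a k • ξ k ω)), ‖v‖ ≤ ∑ k ∈ S, |a k| := by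
  rw [ae_map_iff (aemeasurable_sum_smul hξ a S) (measurableSet_le measurable_norm measurable_const)]
  have h1 : ∀ k, ∀ᵐ ω ∂P, ‖ξ k ω‖ = 1 := fun k =>
    ae_of_ae_map (hξ k).aemeasurable ((hξ k).map_eq ▸ norm_eq_one_ae_sphereUniform d)
  filter_upwards [ae_all_iff.2 h1] with ω hω
  refine (norm_sum_le _ _).trans (Finset.sum_le_sum fun k _ => ?_)
  rw [norm_smul, hω, mul_one, Real.norm_eq_abs]

variable [IsProbabilityMeasure P]

theorem map_sum_smul_map_linearIsometryEquiv (hd : 0 < d)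
    (hξ : ∀ j, HasLaw (ξ j) (sphereUniform d) P) (hi : iIndepFun ξ P) (a : ι → ℝ) (S : Finset ι)
    (L : EuclideanSpace ℝ (Fin d) ≃ₗᵢ[ℝ] EuclideanSpace ℝ (Fin d)) :
    (P.map (fun ω => ∑ k ∈ S, a k • ξ k ω)).map L = P.map (fun ω => ∑ k ∈ S, a k • ξ k ω) := by
  have := isProbabilityMeasure_sphereUniform hd
  have hpi : P.map (fun ω k => ξ k ω) = Measure.pi fun _ : ι => sphereUniform d := by
    rw [(iIndepFun_iff_map_fun_eq_pi_map fun j => (hξ j).aemeasurable).1 hi]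
    simp only [fun j => (hξ j).map_eq]
  have hm : Measurable fun x : ι → EuclideanSpace ℝ (Fin d) => ∑ k ∈ S, a k • x k := by fun_prop
  have hsum : P.map (fun ω => ∑ k ∈ S, a k • ξ k ω) =
      (Measure.pi fun _ : ι => sphereUniform d).map fun x => ∑ k ∈ S, a k • x k := by
    rw [← hpi, AEMeasurable.map_map_of_aemeasurable hm.aemeasurable
      (aemeasurable_pi_lambda _ fun j => (hξ j).aemeasurable)]
    rfl
  have hL : Measurable L := L.continuous.measurable
  have hmp := measurePreserving_pi (fun _ : ι => sphereUniform d) (fun _ : ι => sphereUniform d)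
    (f := fun _ => L) fun _ => ⟨hL, sphereUniform_map_linearIsometryEquiv d L⟩
  rw [hsum, Measure.map_map hL hm]
  conv_rhs => rw [← hmp.map_eq]
  rw [Measure.map_map hm hmp.measurable]
  congr 1
  ext1 x
  simp

theorem integral_norm_sum_smul (hd : 0 < d) (hξ : ∀ j, HasLaw (ξ j) (sphereUniform d) P)
    (hi : iIndepFun ξ P) (a : ι → ℝ) (S : Finset ι) :
    ∫ v, ‖v‖ ^ 2 ∂(P.map (fun ω => ∑ k ∈ S, a k • ξ k ω)) = ∑ k ∈ S, a k ^ 2 ∧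
      ∫ v, ‖v‖ ^ 4 ∂(P.map (fun ω => ∑ k ∈ S, a k • ξ k ω)) ≤
        (1 + 2 / d) * (∑ k ∈ S, a k ^ 2) ^ 2 := by
  classical
  induction S using Finset.induction_on with
  | empty => simp
  | insert k S hk ih =>
    have hmS := aemeasurable_sum_smul hξ a S
    have hind : IndepFun (fun ω => ∑ k ∈ S, a k • ξ k ω) (ξ k) P :=
      (indepFun_sum_smul_of_disjoint hξ hi a (Finset.disjoint_singleton_right.2 hk)).comp
        (φ := id) (ψ := fun x : ({k} : Finset ι) → EuclideanSpace ℝ (Fin d) =>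
          x ⟨k, Finset.mem_singleton_self k⟩) measurable_id (by fun_prop)
    have hprod := (indepFun_iff_map_prod_eq_prod_map_map hmS (hξ k).aemeasurable).1 hind
    rw [(hξ k).map_eq] at hprod
    have := Measure.isProbabilityMeasure_map hmS
    have hstep := integral_norm_add_smul_prod ⟨0, hd⟩ (norm_sum_smul_le_ae hξ a S) (a k)
    have htrans : ∀ m : ℕ, ∫ v, ‖v‖ ^ m ∂(P.map (fun ω => ∑ k ∈ insert k S, a k • ξ k ω)) =
        ∫ q, ‖q.1 + a k • q.2‖ ^ m
          ∂((P.map (fun ω => ∑ k ∈ S, a k • ξ k ω)).prod (sphereUniform d)) := by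
      intro m
      rw [integral_map (aemeasurable_sum_smul hξ a _) (by fun_prop), ← hprod,
        integral_map (hmS.prodMk (hξ k).aemeasurable) (by fun_prop)]
      congr 1
      ext1 ω
      rw [Finset.sum_insert hk, add_comm]
    rw [htrans, htrans, hstep.1, hstep.2, Finset.sum_insert hk, ih.1]
    refine ⟨add_comm _ _, ?_⟩
    have h2 := ih.2
    have hpos : 0 ≤ 2 / (d : ℝ) * (a k ^ 2) ^ 2 := by positivity
    have e : (1 + 2 / (d : ℝ)) * (a k ^ 2 + ∑ k ∈ S, a k ^ 2) ^ 2 =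
        (1 + 2 / d) * (∑ k ∈ S, a k ^ 2) ^ 2 + (2 + 4 / d) * a k ^ 2 * ∑ k ∈ S, a k ^ 2 +
          a k ^ 4 + 2 / (d : ℝ) * (a k ^ 2) ^ 2 := by ring
    rw [e]
    linarith

theorem integral_norm_sum_rpow_eq_pairMoment [DecidableEq ι]
    (hξ : ∀ j, HasLaw (ξ j) (sphereUniform d) P) (hi : iIndepFun ξ P) {p : ℝ} (hp : 0 ≤ p)
    (a : ι → ℝ) {i j : ι} (hij : i ≠ j) :
    ∫ ω, ‖∑ k, a k • ξ k ω‖ ^ p ∂P =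
      pairMoment (P.map (fun ω => ∑ k ∈ (Finset.univ.erase i).erase j, a k • ξ k ω)) (p / 2)
        (a i) (a j) 0 := by
  set S := (Finset.univ.erase i).erase j with hS
  have hmS := aemeasurable_sum_smul hξ a S
  have hdisj : Disjoint S {i, j} := by
    rw [Finset.disjoint_left]
    intro k hk
    simp only [hS, Finset.mem_erase, Finset.mem_univ, and_true] at hk
    simp [hk.1, hk.2]
  have hind : IndepFun (fun ω => ∑ k ∈ S, a k • ξ k ω) (fun ω => (ξ i ω, ξ j ω)) P :=
    (indepFun_sum_smul_of_disjoint hξ hi a hdisj).comp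
      (φ := id) (ψ := fun x : ({i, j} : Finset ι) → EuclideanSpace ℝ (Fin d) =>
        (x ⟨i, by simp⟩, x ⟨j, by simp⟩)) measurable_id (by fun_prop)
  have hmp := (hξ i).aemeasurable.prodMk (hξ j).aemeasurable
  have hprod := (indepFun_iff_map_prod_eq_prod_map_map hmS hmp).1 hind
  rw [(indepFun_iff_map_prod_eq_prod_map_map (hξ i).aemeasurable (hξ j).aemeasurable).1
    (hi.indepFun hij), (hξ i).map_eq, (hξ j).map_eq] at hprod
  rw [pairMoment, ← hprod, integral_map (hmS.prodMk hmp)]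
  · congr 1
    ext1 ω
    rw [add_zero, ← Real.rpow_natCast, ← Real.rpow_mul (norm_nonneg _), Nat.cast_ofNat,
      mul_div_cancel₀ p two_ne_zero]
    congr 2
    rw [← Finset.add_sum_erase _ _ (Finset.mem_univ i), ← Finset.add_sum_erase _ _
      (Finset.mem_erase.2 ⟨hij.symm, Finset.mem_univ j⟩)]
    abel
  · exact (Continuous.rpow_const (by fun_prop)
      fun _ => Or.inr (by positivity)).aestronglyMeasurable

theorem integral_norm_sum_rpow_diff_ge (hd : 2 ≤ d)
    (hξ : ∀ j, HasLaw (ξ j) (sphereUniform d) P) (hi : iIndepFun ξ P) {p : ℝ} (hp : 2 ≤ p)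
    {a a' : ι → ℝ} (ha : ∑ k, a k ^ 2 = 1) {i j : ι} (hij : i ≠ j)
    (haa' : ∀ k, k ≠ i → k ≠ j → a k = a' k)
    (hsq : a i ^ 2 + a j ^ 2 = a' i ^ 2 + a' j ^ 2) (hmul : |a i * a j| ≤ |a' i * a' j|) :
    2 * deficitConst p d * ((a' i * a' j) ^ 2 - (a i * a j) ^ 2) ≤
      ∫ ω, ‖∑ k, a' k • ξ k ω‖ ^ p ∂P - ∫ ω, ‖∑ k, a k • ξ k ω‖ ^ p ∂P := by
  classical
  rw [integral_norm_sum_rpow_eq_pairMoment hξ hi (by linarith) a hij,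
    integral_norm_sum_rpow_eq_pairMoment hξ hi (by linarith) a' hij]
  set S := (Finset.univ.erase i).erase j with hS
  have e : (fun ω => ∑ k ∈ S, a' k • ξ k ω) = fun ω => ∑ k ∈ S, a k • ξ k ω := by
    ext1 ω
    refine Finset.sum_congr rfl fun k hk => ?_
    simp only [hS, Finset.mem_erase, Finset.mem_univ, and_true] at hk
    rw [haa' k hk.2 hk.1]
  rw [e]
  have := Measure.isProbabilityMeasure_map (aemeasurable_sum_smul hξ a S)
  have hsum : ∑ k ∈ S, a k ^ 2 = 1 - (a i ^ 2 + a j ^ 2) := by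
    rw [← Finset.add_sum_erase _ _ (Finset.mem_univ i), ← Finset.add_sum_erase _ _
      (Finset.mem_erase.2 ⟨hij.symm, Finset.mem_univ j⟩)] at ha
    linarith
  have hmom := integral_norm_sum_smul (by omega) hξ hi a S
  rw [hsum] at hmom
  refine pairMoment_diff_ge hd (map_sum_smul_map_linearIsometryEquiv (by omega) hξ hi a S)
    (norm_sum_smul_le_ae hξ a S) hp rfl hsq.symm hmul ?_ hmom.1 hmom.2
  have : 0 ≤ ∑ k ∈ S, a k ^ 2 := Finset.sum_nonneg fun _ _ => sq_nonneg _
  linarith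

end RandomSums

theorem le_const_of_pairwise_smoothing {n : ℕ} (hn : 2 ≤ n) {H : (Fin n → ℝ) → ℝ}
    (hH : ∀ a a' : Fin n → ℝ, ∀ i j, i ≠ j → ∑ k, a k ^ 2 = 1 →
      (∀ k, k ≠ i → k ≠ j → a k = a' k) → a i ^ 2 + a j ^ 2 = a' i ^ 2 + a' j ^ 2 →
      |a i * a j| ≤ |a' i * a' j| → H a ≤ H a') (a : Fin n → ℝ) (ha : ∑ k, a k ^ 2 = 1) :
    H a ≤ H fun _ => 1 / √(n : ℝ) := by
  have hn0 : (0 : ℝ) < n := by exact_mod_cast (by omega : 0 < n)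
  set u : ℝ := 1 / √(n : ℝ) with hu
  have hu0 : 0 < u := by positivity
  have hu2 : u ^ 2 = 1 / n := by rw [hu, div_pow, Real.sq_sqrt hn0.le, one_pow]
  have hsumu : ∑ _k : Fin n, u ^ 2 = 1 := by
    rw [hu2, Finset.sum_const, Finset.card_univ, Fintype.card_fin, nsmul_eq_mul]
    field_simp
  induction hm : (Finset.univ.filter fun k => a k ≠ u).card using Nat.strong_induction_on
    generalizing a with
  | _ m ih =>
    by_cases hall : ∀ k, a k = u
    · rw [show a = fun _ => u from funext hall]
    have hstep : ∀ i j : Fin n, i ≠ j → a i ≠ u → ∀ y : ℝ, u ^ 2 + y ^ 2 = a i ^ 2 + a j ^ 2 →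
        (a j = u → y = u) → |a i * a j| ≤ |u * y| → H a ≤ H fun _ => u := by
      intro i j hij hai y hy hyu hmul
      set a' : Fin n → ℝ := Function.update (Function.update a i u) j y with ha'
      have hi' : a' i = u := by simp [ha', hij]
      have hj' : a' j = y := by simp [ha']
      have hk' : ∀ k, k ≠ i → k ≠ j → a' k = a k := fun k h1 h2 => by simp [ha', h1, h2]
      have hle : H a ≤ H a' := hH a a' i j hij ha (fun k h1 h2 => (hk' k h1 h2).symm)
        (by rw [hi', hj', hy]) (by rwa [hi', hj'])
      refine hle.trans (ih _ ?_ a' ?_ rfl)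
      · rw [← hm]
        refine Finset.card_lt_card (Finset.ssubset_iff_of_subset ?_ |>.2 ⟨i, ?_, ?_⟩)
        · intro k hk
          simp only [Finset.mem_filter, Finset.mem_univ, true_and] at hk ⊢
          by_cases h1 : k = i
          · rwa [h1]
          by_cases h2 : k = j
          · subst h2
            intro h3
            exact hk (hj'.trans (hyu h3))
          · rwa [hk' k h1 h2] at hk
        · simpa using hai
        · simpa using hi'
      · rw [← ha, ← Finset.add_sum_erase _ (fun k => a' k ^ 2) (Finset.mem_univ i),
          ← Finset.add_sum_erase _ (fun k => a' k ^ 2)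
            (Finset.mem_erase.2 ⟨hij.symm, Finset.mem_univ j⟩),
          ← Finset.add_sum_erase _ (fun k => a k ^ 2) (Finset.mem_univ i),
          ← Finset.add_sum_erase _ (fun k => a k ^ 2)
            (Finset.mem_erase.2 ⟨hij.symm, Finset.mem_univ j⟩), ← add_assoc, ← add_assoc, hi', hj',
          hy]
        congr 1
        refine Finset.sum_congr rfl fun k hk => ?_
        simp only [Finset.mem_erase, Finset.mem_univ, and_true] at hk
        rw [hk' k hk.2 hk.1]
    by_cases hsqall : ∀ k, a k ^ 2 = u ^ 2
    · obtain ⟨i, hi⟩ := not_forall.1 hall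
      have : Nontrivial (Fin n) := Fin.nontrivial_iff_two_le.2 hn
      obtain ⟨j, hj⟩ := exists_ne i
      refine hstep i j hj.symm hi (a j) (by rw [hsqall i]) id ?_
      rw [abs_mul, abs_mul, (sq_eq_sq_iff_abs_eq_abs _ _).1 (hsqall i)]
    · have hlt : ∃ i, a i ^ 2 < u ^ 2 := by
        by_contra! h
        obtain ⟨k, hk⟩ := not_forall.1 hsqall
        have := Finset.sum_lt_sum (s := Finset.univ) (fun k _ => h k)
          ⟨k, Finset.mem_univ k, lt_of_le_of_ne (h k) (Ne.symm hk)⟩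
        linarith
      have hgt : ∃ j, u ^ 2 < a j ^ 2 := by
        by_contra! h
        obtain ⟨k, hk⟩ := not_forall.1 hsqall
        have := Finset.sum_lt_sum (s := Finset.univ) (fun k _ => h k)
          ⟨k, Finset.mem_univ k, lt_of_le_of_ne (h k) hk⟩
        linarith
      obtain ⟨i, hi⟩ := hlt
      obtain ⟨j, hj⟩ := hgt
      have hij : i ≠ j := by rintro rfl; linarith
      have hy : √(a i ^ 2 + a j ^ 2 - u ^ 2) ^ 2 = a i ^ 2 + a j ^ 2 - u ^ 2 :=
        Real.sq_sqrt (by nlinarith [sq_nonneg (a i)])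
      refine hstep i j hij (by rintro h; rw [h] at hi; exact lt_irrefl _ hi)
        (√(a i ^ 2 + a j ^ 2 - u ^ 2)) (by rw [hy]; ring)
        (fun h => by rw [h] at hj; exact absurd hj (lt_irrefl _)) ?_
      rw [← sq_le_sq, mul_pow, mul_pow, hy]
      nlinarith

theorem theorem2 (d : ℕ) (hd : 2 ≤ d) (p : ℝ) (hp : 2 ≤ p)
    {Ω : Type*} [MeasurableSpace Ω] (P : Measure Ω) [IsProbabilityMeasure P]
    (n : ℕ) (hn : 2 ≤ n) (ξ : Fin n → Ω → EuclideanSpace ℝ (Fin d))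
    (hξ_law : ∀ j, HasLaw (ξ j) (sphereUniform d) P) (hξ_indep : iIndepFun ξ P)
    (a : Fin n → ℝ) (ha : ∑ j, a j ^ 2 = 1) :
    ∫ ω, ‖∑ j, a j • ξ j ω‖ ^ p ∂P ≤
      ∫ ω, ‖∑ j, (1 / √(n : ℝ)) • ξ j ω‖ ^ p ∂P -
        deficitConst p d * ∑ j, (1 / (n : ℝ) - a j ^ 2) ^ 2 := by
  have hn0 : (0 : ℝ) < n := by exact_mod_cast (by omega : 0 < n)
  have key := le_const_of_pairwise_smoothing hn
    (H := fun a => ∫ ω, ‖∑ j, a j • ξ j ω‖ ^ p ∂P + deficitConst p d * ∑ j, a j ^ 4) (by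
      intro a a' i j hij ha haa' hsq hmul
      have h := integral_norm_sum_rpow_diff_ge hd hξ_law hξ_indep hp ha hij haa' hsq hmul
      have hrest : ∑ k ∈ (Finset.univ.erase i).erase j, a' k ^ 4 =
          ∑ k ∈ (Finset.univ.erase i).erase j, a k ^ 4 := by
        refine Finset.sum_congr rfl fun k hk => ?_
        simp only [Finset.mem_erase, Finset.mem_univ, and_true] at hk
        rw [haa' k hk.2 hk.1]
      have hdiff : ∑ k, a k ^ 4 - ∑ k, a' k ^ 4 =
          2 * ((a' i * a' j) ^ 2 - (a i * a j) ^ 2) := by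
        rw [← Finset.add_sum_erase _ (fun k => a' k ^ 4) (Finset.mem_univ i),
          ← Finset.add_sum_erase _ (fun k => a' k ^ 4)
            (Finset.mem_erase.2 ⟨hij.symm, Finset.mem_univ j⟩),
          ← Finset.add_sum_erase _ (fun k => a k ^ 4) (Finset.mem_univ i),
          ← Finset.add_sum_erase _ (fun k => a k ^ 4)
            (Finset.mem_erase.2 ⟨hij.symm, Finset.mem_univ j⟩), hrest]
        linear_combination (a i ^ 2 + a j ^ 2 + a' i ^ 2 + a' j ^ 2) * hsq
      have hmuldiff : deficitConst p d * (∑ k, a k ^ 4 - ∑ k, a' k ^ 4) =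
          deficitConst p d * (2 * ((a' i * a' j) ^ 2 - (a i * a j) ^ 2)) := by rw [hdiff]
      linarith) a ha
  have hs : ∑ j, (1 / (n : ℝ) - a j ^ 2) ^ 2 = ∑ j, a j ^ 4 - 1 / n := by
    have e : ∀ j, (1 / (n : ℝ) - a j ^ 2) ^ 2 = (1 / n) ^ 2 - 2 / n * a j ^ 2 + a j ^ 4 :=
      fun j => by ring
    simp only [e]
    rw [Finset.sum_add_distrib, Finset.sum_sub_distrib, ← Finset.mul_sum, ha, Finset.sum_const,
      Finset.card_univ, Fintype.card_fin, nsmul_eq_mul]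
    field_simp
    ring
  have hu : ∑ _j : Fin n, (1 / √(n : ℝ)) ^ 4 = 1 / (n : ℝ) := by
    rw [show (1 / √(n : ℝ)) ^ 4 = ((1 / √(n : ℝ)) ^ 2) ^ 2 by ring, div_pow,
      Real.sq_sqrt hn0.le, Finset.sum_const, Finset.card_univ, Fintype.card_fin, nsmul_eq_mul]
    field_simp
  simp only [hu] at key
  rw [hs]
  linarith
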